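/- Let $\Omega=(r_i,r_o)$ with $0<r_i<r_o$ and $\eta=r_i/r_o$ (annulus), or $\Omega=(0,1)$ (pipe). Let $U:\Omega\to\mathbb R$ be $C^1$ (for the pipe, the even extension of $U$ is $C^1$ on $(-1,1)$), and let $U'$ be differentiable in $\Omega$. For $N\ge 0$ and $\alpha\in\mathbb R$ put $$Q(r)=\frac{-rU'(r)}{N^2+r^2},\qquad W_{\alpha,N}(r)=\frac{rQ'(r)}{U(r)-\alpha}.$$ The base flow $U(r)\mathbf e_z$ is called (inviscidly) stable if there are no axial wavenumber $k>0$, azimuthal wavenumber $n\in\{0,1,2,\dots\}$, $c\in\mathbb C$ with $\operatorname{Im}c>0$, and nontrivial twice differentiable $G:\Omega\to\mathbb C$ that satisfy, with $N=n/k$, $$\Big\{\frac{r}{N^2+r^2}(rG)'\Big\}'-k^2G+\frac{Q'}{U-c}\,rG=0\quad\text{in }\Omega,$$ where $G$ tends to $0$ at both walls (annulus), or $G$ tends to $0$ as $r\to1$ and is bounded (non-singular) as $r\to0$ (pipe). **Theorem.** The base flow is stable if for every real $N\ge0$ at least one of the following conditions holds (each imposed at all $r\in\Omega$ where the quotient $W$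 is defined): - KA-I: there is $\alpha\in\mathbb R$ with $W_{\alpha,N}(r)\le 0$ for all $r\in\Omega$; - KA-II: there is $\beta\in\mathbb R$ with $0\le W_{\beta,N}(r)\le H(r)$ for all $r\in\Omega$. Here, for the annulus, $$H=\Big(\frac{\pi}{\ln\eta}\Big)^2\frac1{N^2+r_o^2}+\frac1{N^2}\ \text{ if } N>0,\qquad H=\Big(\frac{\pi}{\ln\eta}\Big)^2\frac1{r_o^2}\ \text{ if } N=0,$$ and for the pipe, $$H(r)=\frac{j_{1,1}^2r^2+N^{-2}}{N^2+1}\ \text{ if } N>0,\qquad H=j_{1,1}^2\ \text{ if } N=0,$$ where $j_{1,1}$ is the first positive zero of the Bessel function $J_1$. -/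

import Mathlib

open Set Filter Topology

noncomputable section

namespace AxisymmetricFlow

/-- The Bessel function of the first kind of order one,
`J₁(x) = ∑ (-1)^m / (m! (m+1)!) (x/2)^(2m+1)`. -/
def besselJ1 (x : ℝ) : ℝ :=
  ∑' m : ℕ, (-1) ^ m / ((m.factorial : ℝ) * ((m + 1).factorial : ℝ)) * (x / 2) ^ (2 * m + 1)

/-- `j_{1,1}`, the first positive zero of `J₁`. -/
def j11 : ℝ := sInf {x : ℝ | 0 < x ∧ besselJ1 x = 0}

/-- `Q(r) = -r U'(r) / (N² + r²)`. -/
def Q (U : ℝ → ℝ) (N r : ℝ) : ℝ := -(r * deriv U r) / (N ^ 2 + r ^ 2)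

/-- `W_{α,N}(r) = r Q'(r) / (U(r) - α)`; meaningful only where `U(r) ≠ α`. -/
def W (U : ℝ → ℝ) (α N r : ℝ) : ℝ := r * deriv (Q U N) r / (U r - α)

/-- `r (rG)' / (N² + r²)`. -/
def flux (N : ℝ) (G : ℝ → ℂ) (r : ℝ) : ℂ :=
  ((r / (N ^ 2 + r ^ 2) : ℝ) : ℂ) * deriv (fun s : ℝ => (s : ℂ) * G s) r

/-- `G` is a nontrivial classical (twice differentiable) solution in `Ω` of
`{r (rG)' / (N² + r²)}' - k² G + Q' r G / (U - c) = 0`. -/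
structure IsSolution (Ω : Set ℝ) (U : ℝ → ℝ) (N k : ℝ) (c : ℂ) (G : ℝ → ℂ) : Prop where
  differentiable : DifferentiableOn ℝ G Ω
  flux_differentiable : DifferentiableOn ℝ (flux N G) Ω
  equation : ∀ r ∈ Ω, deriv (flux N G) r - (k : ℂ) ^ 2 * G r
    + ((deriv (Q U N) r : ℝ) : ℂ) / ((U r : ℂ) - c) * ((r : ℂ) * G r) = 0
  nontrivial : ∃ r ∈ Ω, G r ≠ 0

/-- `c` is an eigenvalue in the annulus `ri < r < ro` for axial wavenumber `k` and azimuthal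
wavenumber `n`: some eigenfunction vanishes at both walls. -/
def AnnulusEigenvalue (ri ro : ℝ) (U : ℝ → ℝ) (k : ℝ) (n : ℕ) (c : ℂ) : Prop :=
  ∃ G : ℝ → ℂ, IsSolution (Ioo ri ro) U (n / k) k c G ∧
    Tendsto G (𝓝[>] ri) (𝓝 0) ∧ Tendsto G (𝓝[<] ro) (𝓝 0)

/-- `c` is an eigenvalue in the pipe `0 < r < 1`: some eigenfunction vanishes at the wall and is
not singular (that is, stays bounded) at the centreline. The other local solutions behave like
`r^(-n-1)` there, so that no further regularity has to be imposed. -/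
def PipeEigenvalue (U : ℝ → ℝ) (k : ℝ) (n : ℕ) (c : ℂ) : Prop :=
  ∃ G : ℝ → ℂ, IsSolution (Ioo 0 1) U (n / k) k c G ∧
    (∃ M : ℝ, ∀ᶠ r in 𝓝[>] 0, ‖G r‖ ≤ M) ∧ Tendsto G (𝓝[<] 1) (𝓝 0)

/-- No eigenvalue with positive imaginary part, for any wavenumbers `k > 0`, `n ≥ 0`. -/
def AnnulusStable (ri ro : ℝ) (U : ℝ → ℝ) : Prop :=
  ∀ (k : ℝ) (n : ℕ) (c : ℂ), 0 < k → AnnulusEigenvalue ri ro U k n c → ¬ 0 < c.im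

/-- No eigenvalue with positive imaginary part, for any wavenumbers `k > 0`, `n ≥ 0`. -/
def PipeStable (U : ℝ → ℝ) : Prop :=
  ∀ (k : ℝ) (n : ℕ) (c : ℂ), 0 < k → PipeEigenvalue U k n c → ¬ 0 < c.im

/-- KA-I: some `W_{α,N}` is nonpositive in `Ω`, wherever it is defined. -/
def KAI (Ω : Set ℝ) (U : ℝ → ℝ) (N : ℝ) : Prop :=
  ∃ α : ℝ, ∀ r ∈ Ω, U r ≠ α → W U α N r ≤ 0

/-- KA-II with threshold `H`: some `W_{β,N}` takes values in `[0, H(r)]` in `Ω`, wherever it is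
defined. -/
def KAII (Ω : Set ℝ) (U : ℝ → ℝ) (N : ℝ) (H : ℝ → ℝ) : Prop :=
  ∃ β : ℝ, ∀ r ∈ Ω, U r ≠ β → W U β N r ∈ Icc 0 (H r)

/-- The KA-II threshold of the annulus (with `η = ri / ro`), constant in `r`. -/
def annulusH (ri ro N : ℝ) (_r : ℝ) : ℝ :=
  if N = 0 then (Real.pi / Real.log (ri / ro)) ^ 2 * (1 / ro ^ 2)
  else (Real.pi / Real.log (ri / ro)) ^ 2 * (1 / (N ^ 2 + ro ^ 2)) + 1 / N ^ 2

/-- The KA-II threshold of the pipe. -/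
def pipeH (N : ℝ) (r : ℝ) : ℝ :=
  if N = 0 then j11 ^ 2 else (j11 ^ 2 * r ^ 2 + 1 / N ^ 2) / (N ^ 2 + 1)

end AxisymmetricFlow

end

/-! Put `φ = r G`, `p = r/(N² + r²)`, `χ = p φ'`, `m = p U' = -Q`, `q = m'`, `w = k²/r`; the
equation becomes `χ' = w φ + q φ/(U - c)`. For real `α` and `λ = (Re c - α)/Im c`, the energy flux
`Re((1 - iλ) χ φ̄)` has derivative `|χ|²/p + w |φ|² + q (U - α) |φ|²/|U - c|²`
(`hasDerivAt_energyFlux`).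

KA-I says `q (U - α) ≥ 0`, so the flux is nondecreasing. Its boundary values leave it no room to
grow, hence it is zero and `φ = 0`.

For KA-II take `α = 2 Re c - β`. Then `(U - α)(U - β) = (U - Re c)² - (Re c - β)² < |U - c|²`, so
the last coefficient is bounded below by `-H/r` (`neg_div_lt_of_mem_Icc`). If `ψ > 0`, `ξ = s ψ'`,
`ξ' = -ρ ψ` and `s ≤ p`, subtracting `(ξ/ψ) |φ|²` from the flux completes a square (Picone) and
leaves the coefficient `w + ρ - H/r` (`eq_zero_of_comparison`). The thresholds are those of `ψ =
sin(ω log(r/ri))` in the annulus and of `J₁(j r)`, or `r J₁(j r)` when `N = 0`, in the pipe. The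
terms in `1/N²` come from `w`, since `1/N² = k²/n² ≤ k²`.

The walls are the delicate point under KA-I: `U` is regular only inside `Ω`, so `q` and `χ` may blow
up. But `U - c` solves the mode equation with `w = 0`, so its Wronskian with `φ` is controlled, and
the monotone quantity `m (U - α)` gives two cases, each with the required one-sided bound on the
flux (`eventually_energyFlux_lt`). Under KA-II, `q/(U - c)` is bounded near the walls and modes are
regular there. -/

noncomputable section

namespace AxisymmetricFlow

/-! ### Modes in Sturm–Liouville form and their energy flux -/

/-- `φ` solves `(p φ')' = w φ + q φ / (U - c)` on `S`, where `m = p U'`, `q = m'` and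
`χ = p φ'`. -/
structure IsMode (S : Set ℝ) (p w U m q : ℝ → ℝ) (c : ℂ) (φ χ : ℝ → ℂ) : Prop where
  p_pos : ∀ r ∈ S, 0 < p r
  w_nonneg : ∀ r ∈ S, 0 ≤ w r
  hasDerivAt_U : ∀ r ∈ S, HasDerivAt U (m r / p r) r
  hasDerivAt_m : ∀ r ∈ S, HasDerivAt m (q r) r
  hasDerivAt_φ : ∀ r ∈ S, HasDerivAt φ (χ r / (p r : ℂ)) r
  hasDerivAt_χ : ∀ r ∈ S, HasDerivAt χ
    ((w r : ℂ) * φ r + (q r : ℂ) / ((U r : ℂ) - c) * φ r) r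

/-- The real part of `(1 - i λ) χ φ̄` with `λ = (Re c - α) / Im c`. -/
def energyFlux (c : ℂ) (α : ℝ) (φ χ : ℝ → ℂ) (r : ℝ) : ℝ :=
  ((χ r).re * (φ r).re + (χ r).im * (φ r).im)
    + (c.re - α) / c.im * ((χ r).im * (φ r).re - (χ r).re * (φ r).im)

theorem hasDerivAt_re {f : ℝ → ℂ} {f' : ℂ} {r : ℝ} (h : HasDerivAt f f' r) :
    HasDerivAt (fun x => (f x).re) f'.re r :=
  Complex.reCLM.hasFDerivAt.comp_hasDerivAt r h

theorem hasDerivAt_im {f : ℝ → ℂ} {f' : ℂ} {r : ℝ} (h : HasDerivAt f f' r) :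
    HasDerivAt (fun x => (f x).im) f'.im r :=
  Complex.imCLM.hasFDerivAt.comp_hasDerivAt r h

theorem hasDerivAt_normSq {f : ℝ → ℂ} {f' : ℂ} {r : ℝ} (h : HasDerivAt f f' r) :
    HasDerivAt (fun x => Complex.normSq (f x))
      (2 * (f'.re * (f r).re + f'.im * (f r).im)) r := by
  have h1 := hasDerivAt_re h
  have h2 := hasDerivAt_im h
  simp only [Complex.normSq_apply]
  exact ((h1.mul h1).add (h2.mul h2)).congr_deriv (by ring)

theorem im_le_norm_sub {c : ℂ} (hc : 0 < c.im) (u : ℝ) : c.im ≤ ‖(u : ℂ) - c‖ := by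
  have := Complex.abs_im_le_norm ((u : ℂ) - c)
  simp only [Complex.sub_im, Complex.ofReal_im, zero_sub, abs_neg] at this
  rwa [abs_of_pos hc] at this

theorem sub_ne_zero_of_im_pos {c : ℂ} (hc : 0 < c.im) (u : ℝ) : (u : ℂ) - c ≠ 0 :=
  norm_pos_iff.1 (hc.trans_le (im_le_norm_sub hc u))

theorem abs_sub_le_mul_norm_sub {c : ℂ} (hc : 0 < c.im) (u α : ℝ) :
    |u - α| ≤ (1 + ‖c - α‖ / c.im) * ‖(u : ℂ) - c‖ := by
  have h1 : |u - α| ≤ ‖(u : ℂ) - c‖ + ‖c - α‖ := by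
    have := norm_add_le ((u : ℂ) - c) (c - α)
    rwa [sub_add_sub_cancel, ← Complex.ofReal_sub, Complex.norm_real, Real.norm_eq_abs] at this
  have h2 : ‖c - α‖ ≤ ‖c - α‖ / c.im * ‖(u : ℂ) - c‖ := by
    rw [div_mul_eq_mul_div, le_div_iff₀ hc]
    exact mul_le_mul_of_nonneg_left (im_le_norm_sub hc u) (norm_nonneg _)
  linarith

namespace IsMode

variable {S : Set ℝ} {p w U m q : ℝ → ℝ} {c : ℂ} {φ χ : ℝ → ℂ}

theorem mono (h : IsMode S p w U m q c φ χ) {T : Set ℝ} (hT : T ⊆ S) :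
    IsMode T p w U m q c φ χ where
  p_pos r hr := h.p_pos r (hT hr)
  w_nonneg r hr := h.w_nonneg r (hT hr)
  hasDerivAt_U r hr := h.hasDerivAt_U r (hT hr)
  hasDerivAt_m r hr := h.hasDerivAt_m r (hT hr)
  hasDerivAt_φ r hr := h.hasDerivAt_φ r (hT hr)
  hasDerivAt_χ r hr := h.hasDerivAt_χ r (hT hr)

/-- `m` and `χ` are `p` times first derivatives, hence odd under reflection, while `q` is even. This
carries estimates at a right wall to a left wall. -/
theorem reflect (h : IsMode S p w U m q c φ χ) :
    IsMode (Neg.neg ⁻¹' S) (fun r => p (-r)) (fun r => w (-r)) (fun r => U (-r))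
      (fun r => -m (-r)) (fun r => q (-r)) c (fun r => φ (-r)) (fun r => -χ (-r)) where
  p_pos r hr := h.p_pos _ hr
  w_nonneg r hr := h.w_nonneg _ hr
  hasDerivAt_U r hr :=
    ((h.hasDerivAt_U _ hr).scomp r (hasDerivAt_neg r)).congr_deriv (by simp [neg_div])
  hasDerivAt_m r hr :=
    (((h.hasDerivAt_m _ hr).scomp r (hasDerivAt_neg r)).neg).congr_deriv (by simp)
  hasDerivAt_φ r hr :=
    ((h.hasDerivAt_φ _ hr).scomp r (hasDerivAt_neg r)).congr_deriv (by simp [neg_div])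
  hasDerivAt_χ r hr :=
    (((h.hasDerivAt_χ _ hr).scomp r (hasDerivAt_neg r)).neg).congr_deriv
      (by simp only [neg_smul, one_smul, neg_neg])

/-- The weight is chosen so that `(1 - iλ)/(U - c)` has real part `(U - α)/|U - c|²`; `α` stays a
free real parameter. -/
theorem hasDerivAt_energyFlux (h : IsMode S p w U m q c φ χ) (hc : 0 < c.im) (α : ℝ)
    {r : ℝ} (hr : r ∈ S) :
    HasDerivAt (energyFlux c α φ χ)
      (Complex.normSq (χ r) / p r + w r * Complex.normSq (φ r)
        + q r * (U r - α) / Complex.normSq ((U r : ℂ) - c) * Complex.normSq (φ r)) r := by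
  have hφ := h.hasDerivAt_φ r hr
  have hχ := h.hasDerivAt_χ r hr
  have a1 := hasDerivAt_re hφ
  have a2 := hasDerivAt_im hφ
  have b1 := hasDerivAt_re hχ
  have b2 := hasDerivAt_im hχ
  have hD : Complex.normSq ((U r : ℂ) - c) ≠ 0 := by
    simpa using sub_ne_zero_of_im_pos hc (U r)
  have hp := (h.p_pos r hr).ne'
  refine (((b1.mul a1).add (b2.mul a2)).add
    (((b2.mul a1).sub (b1.mul a2)).const_mul ((c.re - α) / c.im))).congr_deriv ?_
  have e : (q r : ℂ) / ((U r : ℂ) - c) =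
      ((q r * (U r - c.re) / Complex.normSq ((U r : ℂ) - c) : ℝ) : ℂ)
        + ((q r * c.im / Complex.normSq ((U r : ℂ) - c) : ℝ) : ℂ) * Complex.I := by
    rw [div_eq_mul_inv, Complex.inv_def]
    apply Complex.ext
    · simp; ring
    · simp; ring
  rw [e]
  simp only [Complex.div_ofReal_re, Complex.div_ofReal_im, Complex.add_re, Complex.add_im,
    Complex.mul_re, Complex.mul_im, Complex.ofReal_re, Complex.ofReal_im, Complex.I_re,
    Complex.I_im]
  generalize Complex.normSq ((U r : ℂ) - c) = D at hD
  simp only [Complex.normSq_apply]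
  field_simp
  ring

/-- The Wronskian of `φ` and `U - c`. -/
theorem hasDerivAt_wronskian (h : IsMode S p w U m q c φ χ) (hc : 0 < c.im)
    {r : ℝ} (hr : r ∈ S) :
    HasDerivAt (fun x => ((U x : ℂ) - c) * χ x - (m x : ℂ) * φ x)
      (((U r : ℂ) - c) * (w r * φ r)) r := by
  have hD := sub_ne_zero_of_im_pos hc (U r)
  have hp : (p r : ℂ) ≠ 0 := by exact_mod_cast (h.p_pos r hr).ne'
  -- As `(p U')' = q`, the function `U - c` solves the mode equation with `w = 0`; the terms in `q`
  -- therefore cancel.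
  refine ((((h.hasDerivAt_U r hr).ofReal_comp.sub_const c).mul (h.hasDerivAt_χ r hr)).sub
    ((h.hasDerivAt_m r hr).ofReal_comp.mul (h.hasDerivAt_φ r hr))).congr_deriv ?_
  push_cast
  field_simp
  ring

theorem hasDerivAt_quotient (h : IsMode S p w U m q c φ χ) (hc : 0 < c.im)
    {r : ℝ} (hr : r ∈ S) :
    HasDerivAt (fun x => φ x / ((U x : ℂ) - c))
      ((((U r : ℂ) - c) * χ r - (m r : ℂ) * φ r) / (p r * ((U r : ℂ) - c) ^ 2)) r := by
  have hD := sub_ne_zero_of_im_pos hc (U r)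
  have hp : (p r : ℂ) ≠ 0 := by exact_mod_cast (h.p_pos r hr).ne'
  refine ((h.hasDerivAt_φ r hr).div ((h.hasDerivAt_U r hr).ofReal_comp.sub_const c)
    hD).congr_deriv ?_
  push_cast
  field_simp

/-- The energy flux in terms of the Wronskian of `φ` and `U - c`. -/
theorem energyFlux_le (hc : 0 < c.im) (α : ℝ) (r : ℝ) :
    energyFlux c α φ χ r ≤
      (1 + |c.re - α| / c.im) *
          (‖((U r : ℂ) - c) * χ r - (m r : ℂ) * φ r‖ / ‖(U r : ℂ) - c‖ * ‖φ r‖)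
        + m r * (U r - α) * ‖φ r / ((U r : ℂ) - c)‖ ^ 2 := by
  have hD := sub_ne_zero_of_im_pos hc (U r)
  set D : ℂ := (U r : ℂ) - c with hDdef
  set h : ℂ := D * χ r - (m r : ℂ) * φ r with hh
  have hN : Complex.normSq D ≠ 0 := by simpa using hD
  set z : ℂ := h / D * (starRingEnd ℂ) (φ r) with hz
  have hzn : ‖z‖ = ‖h‖ / ‖D‖ * ‖φ r‖ := by simp [hz]
  have key : energyFlux c α φ χ r =
      z.re + (c.re - α) / c.im * z.im + m r * (U r - α) * ‖φ r / D‖ ^ 2 := by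
    -- The part `m φ/D` of `χ` contributes `m |φ|² Re((1 - iλ)/D)`, which is the last term of the
    -- bound.
    have hχ : χ r = h / D + (m r : ℂ) * φ r * D⁻¹ := by
      rw [hh]; field_simp; ring
    have hDre : D.re = U r - c.re := by simp [hDdef]
    have hDim : D.im = -c.im := by simp [hDdef]
    have e2 : ‖φ r / D‖ ^ 2 = Complex.normSq (φ r) / Complex.normSq D := by
      rw [norm_div, div_pow, ← Complex.normSq_eq_norm_sq, ← Complex.normSq_eq_norm_sq]
    rw [e2, energyFlux, hχ, hz]
    simp only [Complex.add_re, Complex.add_im, Complex.mul_re, Complex.mul_im,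
      Complex.inv_re, Complex.inv_im, Complex.ofReal_re, Complex.ofReal_im, Complex.conj_re,
      Complex.conj_im, hDre, hDim]
    generalize Complex.normSq D = d at hN
    generalize h / D = y
    simp only [Complex.normSq_apply]
    field_simp
    ring
  rw [key, ← hzn]
  have h1 : z.re ≤ ‖z‖ := Complex.re_le_norm z
  have h2 : (c.re - α) / c.im * z.im ≤ |c.re - α| / c.im * ‖z‖ := by
    refine (le_abs_self _).trans ?_
    rw [abs_mul, abs_div, abs_of_pos hc]
    exact mul_le_mul_of_nonneg_left (Complex.abs_im_le_norm z) (by positivity)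
  linarith

end IsMode

/-! ### Mean value estimates near an endpoint -/

theorem norm_sub_le_of_hasDerivAt {S : Set ℝ} (hS : Convex ℝ S) {f f' : ℝ → ℂ} {C : ℝ}
    (hf : ∀ r ∈ S, HasDerivAt f (f' r) r) (hC : ∀ r ∈ S, ‖f' r‖ ≤ C) {x y : ℝ}
    (hx : x ∈ S) (hy : y ∈ S) : ‖f y - f x‖ ≤ C * |y - x| :=
  hS.norm_image_sub_le_of_norm_hasDerivWithin_le
    (fun r hr => (hf r hr).hasDerivWithinAt) hC hx hy

theorem exists_norm_le_of_hasDerivAt {a b : ℝ} {f f' : ℝ → ℂ} {C : ℝ}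
    (hf : ∀ r ∈ Ioo a b, HasDerivAt f (f' r) r) (hC : ∀ r ∈ Ioo a b, ‖f' r‖ ≤ C) :
    ∃ K, ∀ r ∈ Ioo a b, ‖f r‖ ≤ K := by
  rcases (Ioo a b).eq_empty_or_nonempty with h | ⟨x, hx⟩
  · exact ⟨0, by simp [h]⟩
  · refine ⟨‖f x‖ + C * (b - a), fun r hr => ?_⟩
    have h1 := norm_sub_le_of_hasDerivAt (convex_Ioo a b) hf hC hx hr
    have h2 := norm_le_norm_add_norm_sub (f x) (f r)
    have h3 : |r - x| ≤ b - a := by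
      rw [abs_le]; constructor <;> linarith [hx.1, hx.2, hr.1, hr.2]
    have h4 : 0 ≤ C := (norm_nonneg _).trans (hC x hx)
    have h5 : C * |r - x| ≤ C * (b - a) := mul_le_mul_of_nonneg_left h3 h4
    rw [norm_sub_rev (f x) (f r)] at h2
    linarith

/-- A function with bounded derivative that vanishes at an endpoint decays linearly there. -/
theorem norm_le_mul_abs_sub_of_tendsto {S : Set ℝ} (hS : Convex ℝ S) {l : Filter ℝ} [l.NeBot]
    {e : ℝ} (hl : l ≤ 𝓝 e) (hlS : ∀ᶠ x in l, x ∈ S) {f f' : ℝ → ℂ} {C : ℝ}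
    (hf : ∀ r ∈ S, HasDerivAt f (f' r) r) (hC : ∀ r ∈ S, ‖f' r‖ ≤ C)
    (h0 : Tendsto f l (𝓝 0)) {r : ℝ} (hr : r ∈ S) : ‖f r‖ ≤ C * |r - e| := by
  have h1 : Tendsto (fun x => ‖f r - f x‖) l (𝓝 ‖f r - 0‖) :=
    (tendsto_const_nhds.sub h0).norm
  have h2 : Tendsto (fun x => C * |r - x|) l (𝓝 (C * |r - e|)) := by
    have : Tendsto (fun x : ℝ => C * |r - x|) (𝓝 e) (𝓝 (C * |r - e|)) :=
      Continuous.tendsto (by fun_prop) e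
    exact this.mono_left hl
  rw [sub_zero] at h1
  refine le_of_tendsto_of_tendsto h1 h2 ?_
  filter_upwards [hlS] with x hx
  exact norm_sub_le_of_hasDerivAt hS hf hC hx hr

/-- `v` stays above its tangent line, so the integral of `1 / v` is controlled by the square root
of the distance to the wall. -/
theorem mul_normSq_le_of_norm_deriv_le_inv {r b C V s : ℝ} {f f' : ℝ → ℂ} (hrb : r < b)
    (hf : ∀ x ∈ Ico r b, HasDerivAt f (f' x) x) (hC : 0 ≤ C) (hV : 0 < V) (hs : 0 < s)
    (hf' : ∀ x ∈ Ico r b, ‖f' x‖ ≤ C / (V + s * (x - r)))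
    (h0 : Tendsto f (𝓝[<] b) (𝓝 0)) :
    s * V * ‖f r‖ ^ 2 ≤ 4 * C ^ 2 * (b - r) := by
  -- With `y = s (x - r)/V`, `1/(1 + y)` is weakened to `1/√(1 + y)`; `g` is the resulting primitive
  -- vanishing at `r`.
  set g : ℝ → ℝ := fun x => 2 * C / s * (√(1 + s * (x - r) / V) - 1) with hg
  have hpos : ∀ x, r ≤ x → 1 ≤ 1 + s * (x - r) / V := fun x hx => by
    have : 0 ≤ s * (x - r) / V := div_nonneg (mul_nonneg hs.le (by linarith)) hV.le
    linarith
  have hgd : ∀ x, r ≤ x → HasDerivAt g (C / (V * √(1 + s * (x - r) / V))) x := by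
    intro x hx
    have h1 : HasDerivAt (fun x => 1 + s * (x - r) / V) (s / V) x :=
      ((((hasDerivAt_id x).sub_const r).const_mul s).div_const V |>.const_add 1).congr_deriv
        (by simp)
    have h2 := hpos x hx
    have h3 : 0 < √(1 + s * (x - r) / V) := Real.sqrt_pos.2 (by linarith)
    refine (((h1.sqrt (by linarith)).sub_const 1).const_mul (2 * C / s)).congr_deriv ?_
    field_simp
  have hle : ∀ x ∈ Ico r b, ‖f x - f r‖ ≤ g x := by
    intro x hx
    refine image_norm_le_of_norm_deriv_right_le_deriv_boundary'
      (f := fun y => f y - f r) (f' := f') (B := g)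
      (B' := fun y => C / (V * √(1 + s * (y - r) / V))) (a := r) (b := x)
      (fun y hy => ((hf y ⟨hy.1, hy.2.trans_lt hx.2⟩).sub_const _).continuousAt.continuousWithinAt)
      (fun y hy => ((hf y ⟨hy.1, hy.2.trans hx.2⟩).sub_const _).hasDerivWithinAt)
      (by simp [hg]) (fun y hy => (hgd y hy.1).continuousAt.continuousWithinAt)
      (fun y hy => (hgd y hy.1).hasDerivWithinAt) ?_ (right_mem_Icc.2 hx.1)
    intro y hy
    refine (hf' y ⟨hy.1, hy.2.trans hx.2⟩).trans ?_
    have h2 := hpos y hy.1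
    have h3 : √(1 + s * (y - r) / V) ≤ 1 + s * (y - r) / V :=
      Real.sqrt_le_self_iff.2 (Or.inr h2)
    have h4 : V + s * (y - r) = V * (1 + s * (y - r) / V) := by field_simp
    rw [h4]
    have h5 : 0 < √(1 + s * (y - r) / V) := Real.sqrt_pos.2 (by linarith)
    gcongr
  have hlim : ‖f r‖ ≤ g b := by
    have h1 : Tendsto (fun x => ‖f x - f r‖) (𝓝[<] b) (𝓝 ‖0 - f r‖) :=
      (h0.sub tendsto_const_nhds).norm
    have h2 : Tendsto g (𝓝[<] b) (𝓝 (g b)) :=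
      (hgd b hrb.le).continuousAt.tendsto.mono_left nhdsWithin_le_nhds
    rw [zero_sub, norm_neg] at h1
    refine le_of_tendsto_of_tendsto h1 h2 ?_
    filter_upwards [Ico_mem_nhdsLT hrb] with x hx using hle x hx
  have hu : 0 ≤ s * (b - r) / V := by linarith [hpos b hrb.le]
  -- `√(1 + u) - 1 ≤ √u`.
  have hgb : g b ≤ 2 * C / s * √(s * (b - r) / V) := by
    refine mul_le_mul_of_nonneg_left ?_ (by positivity)
    rw [sub_le_iff_le_add, Real.sqrt_le_left (by positivity)]
    nlinarith [Real.sq_sqrt hu, Real.sqrt_nonneg (s * (b - r) / V)]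
  have hsq : ‖f r‖ ^ 2 ≤ (2 * C / s) ^ 2 * (s * (b - r) / V) := by
    have := pow_le_pow_left₀ (norm_nonneg _) (hlim.trans hgb) 2
    rwa [mul_pow, Real.sq_sqrt hu] at this
  calc s * V * ‖f r‖ ^ 2 ≤ s * V * ((2 * C / s) ^ 2 * (s * (b - r) / V)) := by gcongr
    _ = 4 * C ^ 2 * (b - r) := by field_simp; ring

/-! ### The energy flux at a wall where `U` may be singular -/

namespace IsMode

variable {p w U m q : ℝ → ℝ} {c : ℂ} {φ χ : ℝ → ℂ} {a b : ℝ}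

theorem hasDerivAt_mul_sub {S : Set ℝ} (h : IsMode S p w U m q c φ χ) (α : ℝ) {r : ℝ}
    (hr : r ∈ S) :
    HasDerivAt (fun x => m x * (U x - α)) (m r ^ 2 / p r + q r * (U r - α)) r :=
  ((h.hasDerivAt_m r hr).mul ((h.hasDerivAt_U r hr).sub_const α)).congr_deriv (by ring)

/-- The derivative is a square over `p` plus the signed term. Since `m (U - α)` is `p/2` times the
derivative of `(U - α)²`, it follows that `|U - α|` keeps increasing once `m (U - α)` is positive.
-/
theorem monotoneOn_mul_sub (h : IsMode (Ioo a b) p w U m q c φ χ) {α : ℝ}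
    (hq : ∀ r ∈ Ioo a b, 0 ≤ q r * (U r - α)) :
    MonotoneOn (fun x => m x * (U x - α)) (Ioo a b) := by
  refine monotoneOn_of_hasDerivWithinAt_nonneg (convex_Ioo a b)
    (fun r hr => (h.hasDerivAt_mul_sub α hr).continuousAt.continuousWithinAt)
    (fun r hr => (h.hasDerivAt_mul_sub α (interior_subset hr)).hasDerivWithinAt)
    (fun r hr => ?_)
  have hr' := interior_subset hr
  have := (h.p_pos r hr').le
  have := hq r hr'
  positivity

theorem hasDerivAt_sq_sub {S : Set ℝ} (h : IsMode S p w U m q c φ χ) (α : ℝ) {r : ℝ}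
    (hr : r ∈ S) :
    HasDerivAt (fun x => (U x - α) ^ 2) (2 * (m r * (U r - α)) / p r) r :=
  (((h.hasDerivAt_U r hr).sub_const α).pow 2).congr_deriv (by ring)

/-- If `|U - c|` is nondecreasing up to a factor `A`, then it dominates the Wronskian of `φ` and
`U - c`. -/
theorem wronskian_div_le (h : IsMode (Ioo a b) p w U m q c φ χ) (hc : 0 < c.im)
    {w₁ Φ A r₁ : ℝ} (hr₁ : r₁ ∈ Ioo a b)
    (hw : ∀ r ∈ Ioo a b, w r ≤ w₁) (hΦ : ∀ r ∈ Ioo a b, ‖φ r‖ ≤ Φ)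
    (hA : ∀ r ∈ Ico r₁ b, ∀ x ∈ Icc r₁ r, ‖(U x : ℂ) - c‖ ≤ A * ‖(U r : ℂ) - c‖) :
    ∃ K, 0 ≤ K ∧ ∀ r ∈ Ico r₁ b,
      ‖((U r : ℂ) - c) * χ r - (m r : ℂ) * φ r‖ / ‖(U r : ℂ) - c‖ ≤ K := by
  set W : ℝ → ℂ := fun r => ((U r : ℂ) - c) * χ r - (m r : ℂ) * φ r with hW
  have hw₁ : 0 ≤ w₁ := (h.w_nonneg r₁ hr₁).trans (hw r₁ hr₁)
  have hΦ0 : 0 ≤ Φ := (norm_nonneg _).trans (hΦ r₁ hr₁)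
  have hA0 : 0 ≤ A := by
    have := hA r₁ (left_mem_Ico.2 hr₁.2) r₁ (left_mem_Icc.2 le_rfl)
    have h0 : 0 < ‖(U r₁ : ℂ) - c‖ := hc.trans_le (im_le_norm_sub hc _)
    by_contra! hlt
    nlinarith
  -- The initial value is divided by `|U - c| ≥ Im c`; the increment is at most `A |U(r) - c| w₁ Φ
  -- (b - r₁)`.
  refine ⟨‖W r₁‖ / c.im + A * (w₁ * Φ) * (b - r₁), ?_, fun r hr => ?_⟩
  · have := hr₁.2
    have : 0 ≤ b - r₁ := by linarith
    positivity
  have hD : 0 < ‖(U r : ℂ) - c‖ := hc.trans_le (im_le_norm_sub hc _)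
  have hsub : Icc r₁ r ⊆ Ioo a b := fun x hx => ⟨hr₁.1.trans_le hx.1, hx.2.trans_lt hr.2⟩
  have h1 := norm_sub_le_of_hasDerivAt (convex_Icc r₁ r)
    (C := A * ‖(U r : ℂ) - c‖ * (w₁ * Φ))
    (fun x hx => h.hasDerivAt_wronskian hc (hsub hx)) (fun x hx => by
      rw [norm_mul, norm_mul, Complex.norm_real, Real.norm_eq_abs,
        abs_of_nonneg (h.w_nonneg x (hsub hx))]
      have e1 := hA r hr x hx
      have e2 := hw x (hsub hx)
      have e3 := hΦ x (hsub hx)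
      have e4 := h.w_nonneg x (hsub hx)
      gcongr)
    (left_mem_Icc.2 hr.1) (right_mem_Icc.2 hr.1)
  change ‖W r - W r₁‖ ≤ _ at h1
  have h2 := norm_le_norm_add_norm_sub (W r₁) (W r)
  rw [norm_sub_rev (W r₁) (W r)] at h2
  rw [abs_of_nonneg (by linarith [hr.1])] at h1
  rw [div_le_iff₀ hD]
  have h3 : ‖W r₁‖ ≤ ‖W r₁‖ / c.im * ‖(U r : ℂ) - c‖ := by
    rw [div_mul_eq_mul_div, le_div_iff₀ hc]
    exact mul_le_mul_of_nonneg_left (im_le_norm_sub hc _) (norm_nonneg _)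
  have h4 : A * ‖(U r : ℂ) - c‖ * (w₁ * Φ) * (r - r₁) ≤
      A * ‖(U r : ℂ) - c‖ * (w₁ * Φ) * (b - r₁) := by
    have := hr.2
    gcongr
  change ‖W r‖ ≤ _
  nlinarith

/-- At a wall the energy flux has no positive limit points, whatever the behaviour of `U` there. -/
theorem eventually_energyFlux_lt (h : IsMode (Ioo a b) p w U m q c φ χ) (hab : a < b)
    (hc : 0 < c.im) {α p₀ p₁ w₁ Φ : ℝ} (hp₀ : 0 < p₀) (hpl : ∀ r ∈ Ioo a b, p₀ ≤ p r)
    (hpu : ∀ r ∈ Ioo a b, p r ≤ p₁) (hw : ∀ r ∈ Ioo a b, w r ≤ w₁)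
    (hΦ : ∀ r ∈ Ioo a b, ‖φ r‖ ≤ Φ) (hq : ∀ r ∈ Ioo a b, 0 ≤ q r * (U r - α))
    (hφ : Tendsto φ (𝓝[<] b) (𝓝 0)) {ε : ℝ} (hε : 0 < ε) :
    ∀ᶠ r in 𝓝[<] b, energyFlux c α φ χ r < ε := by
  have hmono := h.monotoneOn_mul_sub hq
  set L : ℝ := 1 + ‖c - α‖ / c.im with hL
  have hL0 : 0 < L := by positivity
  have hVD : ∀ r, |U r - α| ≤ L * ‖(U r : ℂ) - c‖ := fun r => abs_sub_le_mul_norm_sub hc _ _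
  have hDV : ∀ r, ‖(U r : ℂ) - c‖ ≤ |U r - α| + ‖c - α‖ := fun r => by
    have := norm_sub_le (((U r - α : ℝ)) : ℂ) (c - α)
    rw [Complex.norm_real, Real.norm_eq_abs] at this
    refine le_trans (le_of_eq ?_) this
    congr 1; push_cast; ring
  set P : ℝ := 1 + |c.re - α| / c.im with hP
  suffices H : ∃ K C : ℝ, ∀ᶠ r in 𝓝[<] b, energyFlux c α φ χ r ≤ K * ‖φ r‖ + C * (b - r) by
    obtain ⟨K, C, H⟩ := H
    have ht : Tendsto (fun r => K * ‖φ r‖ + C * (b - r)) (𝓝[<] b)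
        (𝓝 (K * ‖(0:ℂ)‖ + C * (b - b))) := by
      refine (hφ.norm.const_mul K).add ?_
      have : Tendsto (fun r => C * (b - r)) (𝓝 b) (𝓝 (C * (b - b))) :=
        Continuous.tendsto (by fun_prop) b
      exact this.mono_left nhdsWithin_le_nhds
    simp only [norm_zero, mul_zero, sub_self, add_zero] at ht
    filter_upwards [H, ht.eventually (gt_mem_nhds hε)] with r h1 h2 using h1.trans_lt h2
  -- First case: `|U - α|` is nonincreasing, so `U` stays bounded near `b`, and the last term of
  -- `energyFlux_le` is nonpositive.
  by_cases hM : ∀ r ∈ Ioo a b, m r * (U r - α) ≤ 0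
  · have hanti : AntitoneOn (fun x => (U x - α) ^ 2) (Ioo a b) := by
      refine antitoneOn_of_hasDerivWithinAt_nonpos (convex_Ioo a b)
        (fun r hr => (h.hasDerivAt_sq_sub α hr).continuousAt.continuousWithinAt)
        (fun r hr => (h.hasDerivAt_sq_sub α (interior_subset hr)).hasDerivWithinAt)
        (fun r hr => ?_)
      have hr' := interior_subset hr
      exact div_nonpos_of_nonpos_of_nonneg (by linarith [hM r hr']) (h.p_pos r hr').le
    obtain ⟨r₁, hr₁⟩ := nonempty_Ioo.2 hab
    obtain ⟨K, hK0, hK⟩ := h.wronskian_div_le hc (A := (|U r₁ - α| + ‖c - α‖) / c.im) hr₁ hw hΦ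
      (fun r hr x hx => by
        have hx' : x ∈ Ioo a b := ⟨hr₁.1.trans_le hx.1, hx.2.trans_lt hr.2⟩
        have h1 : |U x - α| ≤ |U r₁ - α| := 
          sq_le_sq.1 (hanti hr₁ hx' hx.1)
        rw [div_mul_eq_mul_div, le_div_iff₀ hc]
        have h2 := hDV x
        have h3 := im_le_norm_sub hc (U r)
        have : ‖(U x : ℂ) - c‖ ≤ |U r₁ - α| + ‖c - α‖ := by linarith
        gcongr)
    refine ⟨P * K, 0, ?_⟩
    filter_upwards [Ico_mem_nhdsLT hr₁.2] with r hr
    have hr' : r ∈ Ioo a b := ⟨hr₁.1.trans_le hr.1, hr.2⟩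
    refine (energyFlux_le (m := m) (U := U) hc α r).trans ?_
    have h1 : m r * (U r - α) * ‖φ r / ((U r : ℂ) - c)‖ ^ 2 ≤ 0 :=
      mul_nonpos_of_nonpos_of_nonneg (hM r hr') (by positivity)
    have h2 := mul_le_mul_of_nonneg_left
      (mul_le_mul_of_nonneg_right (hK r hr) (norm_nonneg (φ r))) (show 0 ≤ P by positivity)
    linarith
  · push Not at hM
    obtain ⟨r₁, hr₁, hM₁⟩ := hM
    have hsub : Ico r₁ b ⊆ Ioo a b := fun x hx => ⟨hr₁.1.trans_le hx.1, hx.2⟩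
    have hMpos : ∀ r ∈ Ico r₁ b, 0 < m r * (U r - α) := fun r hr =>
      hM₁.trans_le (hmono hr₁ (hsub hr) hr.1)
    -- Second case: beyond `r₁` the difference `U - α` has no zero, hence a constant sign `σ`. Then
    -- `v = σ (U - α)` is positive and `p v' = σ m` is positive and nondecreasing.
    obtain ⟨σ, hσ, hv⟩ : ∃ σ : ℝ, σ ^ 2 = 1 ∧ ∀ r ∈ Ico r₁ b, 0 < σ * (U r - α) := by
      have hcont : ContinuousOn (fun r => U r - α) (Ico r₁ b) := fun r hr =>
        ((h.hasDerivAt_U r (hsub hr)).continuousAt.sub continuousAt_const).continuousWithinAt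
      have hne : ∀ r ∈ Ico r₁ b, U r - α ≠ 0 := fun r hr h0 => by
        have := hMpos r hr; rw [h0, mul_zero] at this; exact lt_irrefl _ this
      have hr₁' : r₁ ∈ Ico r₁ b := left_mem_Ico.2 hr₁.2
      rcases (hne r₁ hr₁').lt_or_gt with h0 | h0
      · refine ⟨-1, by norm_num, fun r hr => ?_⟩
        by_contra! hcon
        obtain ⟨y, hy, hy0⟩ := isPreconnected_Ico.intermediate_value hr₁' hr hcont
          (show (0:ℝ) ∈ Icc (U r₁ - α) (U r - α) from ⟨h0.le, by linarith⟩)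
        exact hne y hy hy0
      · refine ⟨1, by norm_num, fun r hr => ?_⟩
        by_contra! hcon
        obtain ⟨y, hy, hy0⟩ := isPreconnected_Ico.intermediate_value hr hr₁' hcont
          (show (0:ℝ) ∈ Icc (U r - α) (U r₁ - α) from ⟨by linarith, h0.le⟩)
        exact hne y hy hy0
    have hn : ∀ r ∈ Ico r₁ b, 0 < σ * m r := fun r hr => by
      have h1 := hMpos r hr
      have h2 := hv r hr
      have h3 : (σ * m r) * (σ * (U r - α)) = m r * (U r - α) := by
        linear_combination (m r * (U r - α)) * hσ
      exact pos_of_mul_pos_left (h3 ▸ h1) h2.le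
    have hq' : ∀ r ∈ Ico r₁ b, 0 ≤ σ * q r := fun r hr => by
      have h1 := hq r (hsub hr)
      have h2 := hv r hr
      have h3 : (σ * q r) * (σ * (U r - α)) = q r * (U r - α) := by
        linear_combination (q r * (U r - α)) * hσ
      exact nonneg_of_mul_nonneg_left (h3 ▸ h1) h2
    have hnmono : MonotoneOn (fun x => σ * m x) (Ico r₁ b) := by
      refine monotoneOn_of_hasDerivWithinAt_nonneg (convex_Ico r₁ b)
        (fun r hr => ((h.hasDerivAt_m r (hsub hr)).const_mul σ).continuousAt.continuousWithinAt)
        (fun r hr => ((h.hasDerivAt_m r (hsub (interior_subset hr))).const_mul σ).hasDerivWithinAt)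
        (fun r hr => hq' r (interior_subset hr))
    have hp₁ : 0 < p₁ := (h.p_pos r₁ hr₁).trans_le (hpu r₁ hr₁)
    have hvd : ∀ r ∈ Ico r₁ b, HasDerivAt (fun x => σ * (U x - α)) (σ * (m r / p r)) r :=
      fun r hr => ((h.hasDerivAt_U r (hsub hr)).sub_const α).const_mul σ
    -- As `p ≤ p₁`, the slope of `v` beyond `r` is at least `σ m(r)/p₁`.
    have htan : ∀ r ∈ Ico r₁ b, ∀ x ∈ Ico r b,
        σ * (U r - α) + σ * m r / p₁ * (x - r) ≤ σ * (U x - α) := by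
      intro r hr x hx
      have hsub' : Ico r b ⊆ Ico r₁ b := Ico_subset_Ico_left hr.1
      have := (convex_Ico r b).mul_sub_le_image_sub_of_le_deriv
        (f := fun x => σ * (U x - α)) (C := σ * m r / p₁)
        (fun y hy => (hvd y (hsub' hy)).continuousAt.continuousWithinAt)
        (fun y hy => (hvd y (hsub' (interior_subset hy))).differentiableAt.differentiableWithinAt)
        (fun y hy => by
          have hy' := interior_subset hy
          rw [(hvd y (hsub' hy')).deriv, ← mul_div_assoc]
          have e1 : σ * m r ≤ σ * m y := hnmono hr (hsub' hy') hy'.1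
          have e2 := hpu y (hsub (hsub' hy'))
          have e3 := h.p_pos y (hsub (hsub' hy'))
          have e4 := hn r hr
          have e5 := e4.le.trans e1
          gcongr)
        r (left_mem_Ico.2 hr.2) x hx hx.1
      linarith
    have habs : ∀ r ∈ Ico r₁ b, |U r - α| = σ * (U r - α) := fun r hr => by
      have hs : |σ| = 1 := by
        have := sq_eq_sq_iff_abs_eq_abs σ 1 |>.1 (by simpa using hσ)
        simpa using this
      rw [← abs_of_pos (hv r hr), abs_mul, hs, one_mul]
    have hvmono : ∀ r ∈ Ico r₁ b, ∀ x ∈ Ico r b, |U r - α| ≤ |U x - α| := fun r hr x hx => by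
      rw [habs r hr, habs x ⟨hr.1.trans hx.1, hx.2⟩]
      have := htan r hr x hx
      have e : 0 ≤ σ * m r / p₁ * (x - r) :=
        mul_nonneg (div_nonneg (hn r hr).le hp₁.le) (by linarith [hx.1])
      linarith
    obtain ⟨K, hK0, hK⟩ := h.wronskian_div_le hc
      (A := L + ‖c - α‖ / c.im) hr₁ hw hΦ (fun r hr x hx => by
        have h1 := hvmono x ⟨hx.1, hx.2.trans_lt hr.2⟩ r ⟨hx.2, hr.2⟩
        have h2 := hDV x
        have h3 := hVD r
        have h4 : ‖c - α‖ ≤ ‖c - α‖ / c.im * ‖(U r : ℂ) - c‖ := by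
          rw [div_mul_eq_mul_div, le_div_iff₀ hc]
          exact mul_le_mul_of_nonneg_left (im_le_norm_sub hc _) (norm_nonneg _)
        linarith)
    have hf0 : Tendsto (fun x => φ x / ((U x : ℂ) - c)) (𝓝[<] b) (𝓝 0) := by
      refine squeeze_zero_norm (a := fun x => ‖φ x‖ / c.im) (fun x => ?_) ?_
      · rw [norm_div]
        have := im_le_norm_sub hc (U x)
        gcongr
      · simpa using hφ.norm.div_const c.im
    set C : ℝ := K * L / p₀ with hC
    refine ⟨P * K, 4 * C ^ 2 * p₁, ?_⟩
    filter_upwards [Ico_mem_nhdsLT hr₁.2] with r hr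
    refine (energyFlux_le (m := m) (U := U) hc α r).trans ?_
    have h2 := mul_le_mul_of_nonneg_left
      (mul_le_mul_of_nonneg_right (hK r hr) (norm_nonneg (φ r))) (show 0 ≤ P by positivity)
    have hsub' : Ico r b ⊆ Ico r₁ b := Ico_subset_Ico_left hr.1
    -- Applied to `f = φ/(U - c)`, where `|f'| ≤ K/(p₀ |U - c|)`. The product `s V` is `m (U -
    -- α)/p₁`, so this bounds the dangerous last term of `energyFlux_le` by a multiple of `b - r`.
    have h3 := mul_normSq_le_of_norm_deriv_le_inv (C := C) (V := σ * (U r - α))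
      (s := σ * m r / p₁) hr.2
      (fun x hx => h.hasDerivAt_quotient hc (hsub (hsub' hx))) (by positivity) (hv r hr)
      (div_pos (hn r hr) hp₁) (fun x hx => by
        have e1 := htan r hr x hx
        rw [← habs x (hsub' hx)] at e1
        have e2 := hVD x
        have e3 : 0 < σ * (U r - α) + σ * m r / p₁ * (x - r) :=
          add_pos_of_pos_of_nonneg (hv r hr)
            (mul_nonneg (div_nonneg (hn r hr).le hp₁.le) (by linarith [hx.1]))
        have hD : 0 < ‖(U x : ℂ) - c‖ := hc.trans_le (im_le_norm_sub hc _)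
        have e4 := hK x (hsub' hx)
        have e5 := hpl x (hsub (hsub' hx))
        have e6 := h.p_pos x (hsub (hsub' hx))
        rw [norm_div, norm_mul, norm_pow, Complex.norm_real, Real.norm_eq_abs, abs_of_pos e6]
        calc _ = (‖((U x : ℂ) - c) * χ x - (m x : ℂ) * φ x‖ / ‖(U x : ℂ) - c‖)
                / (p x * ‖(U x : ℂ) - c‖) := by field_simp
          _ ≤ K / (p₀ * ‖(U x : ℂ) - c‖) := by gcongr
          _ ≤ K * L / p₀ / (σ * (U r - α) + σ * m r / p₁ * (x - r)) := by
            rw [div_div, div_le_div_iff₀ (by positivity) (by positivity)]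
            have : σ * (U r - α) + σ * m r / p₁ * (x - r) ≤ L * ‖(U x : ℂ) - c‖ := e1.trans e2
            calc _ ≤ K * (p₀ * (L * ‖(U x : ℂ) - c‖)) := by gcongr
              _ = _ := by ring) hf0
    have h4 : m r * (U r - α) * ‖φ r / ((U r : ℂ) - c)‖ ^ 2 ≤ 4 * C ^ 2 * p₁ * (b - r) := by
      have e : m r * (U r - α) = p₁ * (σ * m r / p₁ * (σ * (U r - α))) := by
        field_simp
        linear_combination -(m r * (U r - α)) * hσ
      rw [e, mul_assoc]
      calc _ ≤ p₁ * (4 * C ^ 2 * (b - r)) := mul_le_mul_of_nonneg_left h3 hp₁.le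
        _ = _ := by ring
    linarith

end IsMode

/-! ### Boundary terms, and zeros of `U - β` -/

theorem abs_energyFlux_le (c : ℂ) (α : ℝ) (φ χ : ℝ → ℂ) (r : ℝ) :
    |energyFlux c α φ χ r| ≤ (1 + |(c.re - α) / c.im|) * (‖χ r‖ * ‖φ r‖) := by
  set z : ℂ := χ r * (starRingEnd ℂ) (φ r) with hz
  have hzn : ‖z‖ = ‖χ r‖ * ‖φ r‖ := by simp [hz]
  have e : energyFlux c α φ χ r = z.re + (c.re - α) / c.im * z.im := by
    simp only [energyFlux, hz, Complex.mul_re, Complex.mul_im, Complex.conj_re, Complex.conj_im]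
    ring
  rw [e, ← hzn]
  refine (abs_add_le _ _).trans ?_
  rw [abs_mul]
  have h1 := Complex.abs_re_le_norm z
  have h2 := mul_le_mul_of_nonneg_left (Complex.abs_im_le_norm z)
    (abs_nonneg ((c.re - α) / c.im))
  linarith

theorem tendsto_energyFlux {c : ℂ} {α K : ℝ} {φ χ : ℝ → ℂ} {l : Filter ℝ}
    (hχ : ∀ᶠ r in l, ‖χ r‖ ≤ K) (hφ : Tendsto φ l (𝓝 0)) :
    Tendsto (energyFlux c α φ χ) l (𝓝 0) := by
  refine squeeze_zero_norm' (a := fun r => (1 + |(c.re - α) / c.im|) * (K * ‖φ r‖)) ?_ ?_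
  · filter_upwards [hχ] with r hr
    refine (abs_energyFlux_le c α φ χ r).trans ?_
    gcongr
  · simpa using (hφ.norm.const_mul K).const_mul (1 + |(c.re - α) / c.im|)

/-- `|φ|²/|ψ| = (|φ|/|ψ|) |φ|` is a bounded factor times one tending to zero. This disposes of the
boundary term in Picone's identity. -/
theorem tendsto_div_mul_normSq {ξ ψ : ℝ → ℝ} {φ : ℝ → ℂ} {l : Filter ℝ}
    (hξ : ξ =O[l] (fun _ => (1 : ℝ))) (hψ : φ =O[l] ψ) (hφ : Tendsto φ l (𝓝 0)) :
    Tendsto (fun r => ξ r / ψ r * Complex.normSq (φ r)) l (𝓝 0) := by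
  obtain ⟨A, hA0, hA⟩ := hξ.exists_nonneg
  obtain ⟨B, hB0, hB⟩ := hψ.exists_nonneg
  refine squeeze_zero_norm' (a := fun r => A * (B * ‖φ r‖)) ?_ ?_
  · filter_upwards [hA.bound, hB.bound] with r h1 h2
    rw [norm_one, mul_one] at h1
    rw [Complex.normSq_eq_norm_sq, norm_mul, norm_div, norm_pow, norm_norm]
    rcases eq_or_ne (ψ r) 0 with h0 | h0
    · rw [h0]; simp; positivity
    · have h3 : 0 < ‖ψ r‖ := norm_pos_iff.2 h0
      calc ‖ξ r‖ / ‖ψ r‖ * ‖φ r‖ ^ 2 = ‖ξ r‖ * (‖φ r‖ / ‖ψ r‖ * ‖φ r‖) := by field_simp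
        _ ≤ A * (B * ‖φ r‖) := by
          have : ‖φ r‖ / ‖ψ r‖ ≤ B := (div_le_iff₀ h3).2 h2
          gcongr
  · simpa using (hφ.norm.const_mul B).const_mul A

/-- If `V' = m / p`, `m' = q` and `|q| ≤ M |V|` off the zeros of `V`, then `q` vanishes at the
zeros of `V` as well. -/
theorem eq_zero_of_abs_le_mul_abs {V m p q : ℝ → ℝ} {r₀ M : ℝ} {S : Set ℝ} (hS : IsOpen S)
    (hr₀ : r₀ ∈ S) (hp : ∀ r ∈ S, 0 < p r) (hV : ∀ r ∈ S, HasDerivAt V (m r / p r) r)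
    (hm : ∀ r ∈ S, HasDerivAt m (q r) r) (h0 : V r₀ = 0)
    (hM : ∀ r ∈ S, V r ≠ 0 → |q r| ≤ M * |V r|) : q r₀ = 0 := by
  by_contra hq
  have hne : ∀ᶠ x in 𝓝[>] r₀, V x ≠ 0 := by
    have hle : 𝓝[>] r₀ ≤ 𝓝[≠] r₀ := nhdsWithin_mono _ fun x hx => ne_of_gt hx
    -- If `m r₀ ≠ 0`, the zero of `V` is simple. Otherwise `m' = q ≠ 0` at `r₀` keeps `m` from
    -- vanishing just to the right, and Rolle excludes a second zero of `V`.
    rcases eq_or_ne (m r₀) 0 with hm0 | hm0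
    · have h1 : ∀ᶠ x in 𝓝[>] r₀, m x ≠ 0 := hle ((hm r₀ hr₀).eventually_ne hq)
      have h2 : ∀ᶠ x in 𝓝[>] r₀, x ∈ S := nhdsWithin_le_nhds (hS.mem_nhds hr₀)
      obtain ⟨d, hd, hsub⟩ := mem_nhdsGT_iff_exists_Ioo_subset.1 (h1.and h2)
      filter_upwards [Ioo_mem_nhdsGT hd] with x hx hx0
      have hmem : ∀ y ∈ Icc r₀ x, y ∈ S := fun y hy => by
        rcases hy.1.eq_or_lt with rfl | hlt
        · exact hr₀
        · exact (hsub ⟨hlt, hy.2.trans_lt hx.2⟩).2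
      obtain ⟨y, hy, hy0⟩ := exists_hasDerivAt_eq_zero (f := V) hx.1
        (fun y hy => (hV y (hmem y hy)).continuousAt.continuousWithinAt) (h0.trans hx0.symm)
        (fun y hy => hV y (hmem y (Ioo_subset_Icc_self hy)))
      have h3 := hsub ⟨hy.1, hy.2.trans hx.2⟩
      exact div_ne_zero h3.1 (hp y h3.2).ne' hy0
    · exact hle ((hV r₀ hr₀).eventually_ne (div_ne_zero hm0 (hp r₀ hr₀).ne'))
  have hS' : ∀ᶠ x in 𝓝[>] r₀, x ∈ S := nhdsWithin_le_nhds (hS.mem_nhds hr₀)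
  have hV0 : Tendsto V (𝓝[>] r₀) (𝓝 0) := by
    have := (hV r₀ hr₀).continuousAt.tendsto
    rw [h0] at this
    exact this.mono_left nhdsWithin_le_nhds
  have hq0 : Tendsto (deriv m) (𝓝[>] r₀) (𝓝 0) := by
    refine squeeze_zero_norm' (a := fun x => M * ‖V x‖) ?_ (by simpa using hV0.norm.const_mul M)
    filter_upwards [hne, hS'] with x h1 h2
    rw [(hm x h2).deriv]
    exact hM x h2 h1
  -- `q` need not be continuous, but a one-sided limit of `m'` at `r₀` must equal the derivative
  -- there.
  have hd := hasDerivWithinAt_Ici_of_tendsto_deriv (s := S)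
    (fun x hx => (hm x hx).differentiableAt.differentiableWithinAt)
    (hm r₀ hr₀).continuousAt.continuousWithinAt hS' hq0
  exact hq (uniqueDiffWithinAt_Ici r₀ |>.eq_deriv _ (hm r₀ hr₀).hasDerivWithinAt hd)

/-! ### Left walls, Picone's identity and comparison -/

namespace IsMode

variable {p w U m q : ℝ → ℝ} {c : ℂ} {φ χ : ℝ → ℂ} {a b : ℝ}

theorem eventually_lt_energyFlux (h : IsMode (Ioo a b) p w U m q c φ χ) (hab : a < b)
    (hc : 0 < c.im) {α p₀ p₁ w₁ Φ : ℝ} (hp₀ : 0 < p₀) (hpl : ∀ r ∈ Ioo a b, p₀ ≤ p r)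
    (hpu : ∀ r ∈ Ioo a b, p r ≤ p₁) (hw : ∀ r ∈ Ioo a b, w r ≤ w₁)
    (hΦ : ∀ r ∈ Ioo a b, ‖φ r‖ ≤ Φ) (hq : ∀ r ∈ Ioo a b, 0 ≤ q r * (U r - α))
    (hφ : Tendsto φ (𝓝[>] a) (𝓝 0)) {ε : ℝ} (hε : 0 < ε) :
    ∀ᶠ r in 𝓝[>] a, -ε < energyFlux c α φ χ r := by
  have hmem : ∀ r ∈ Ioo (-b) (-a), -r ∈ Ioo a b := fun r hr =>
    ⟨by linarith [hr.2], by linarith [hr.1]⟩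
  have hneg : Tendsto (fun r : ℝ => -r) (𝓝[<] (-a)) (𝓝[>] a) := by
    simpa using tendsto_neg_nhdsLT (a := -a)
  have hneg' : Tendsto (fun r : ℝ => -r) (𝓝[>] a) (𝓝[<] (-a)) := tendsto_neg_nhdsGT
  have hR := (h.reflect.mono (T := Ioo (-b) (-a)) hmem).eventually_energyFlux_lt
    (neg_lt_neg hab) hc hp₀ (fun r hr => hpl _ (hmem r hr)) (fun r hr => hpu _ (hmem r hr))
    (fun r hr => hw _ (hmem r hr)) (fun r hr => hΦ _ (hmem r hr)) (α := α)
    (fun r hr => hq _ (hmem r hr)) (hφ.comp hneg) hε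
  filter_upwards [hneg'.eventually hR] with r hr
  have e : energyFlux c α (fun r => φ (-r)) (fun r => -χ (-r)) (-r) = -energyFlux c α φ χ r := by
    simp only [energyFlux, neg_neg, Complex.neg_re, Complex.neg_im]
    ring
  rw [e] at hr
  linarith

/-- Picone-type identity: a Riccati subsolution forces `φ = 0`. -/
theorem eq_zero_of_riccati (h : IsMode (Ioo a b) p w U m q c φ χ) (hc : 0 < c.im) (α : ℝ)
    {g g' : ℝ → ℝ} (hg : ∀ r ∈ Ioo a b, HasDerivAt g (g' r) r)
    (hpos : ∀ r ∈ Ioo a b, 0 < w r - g' r - g r ^ 2 / p r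
      + q r * (U r - α) / Complex.normSq ((U r : ℂ) - c))
    (hb : ∀ ε > 0, ∀ᶠ r in 𝓝[<] b,
      energyFlux c α φ χ r - g r * Complex.normSq (φ r) < ε)
    (ha : ∀ ε > 0, ∀ᶠ r in 𝓝[>] a,
      -ε < energyFlux c α φ χ r - g r * Complex.normSq (φ r)) :
    ∀ r ∈ Ioo a b, φ r = 0 := by
  set E : ℝ → ℝ := fun r => energyFlux c α φ χ r - g r * Complex.normSq (φ r) with hE
  -- Completing the square: the terms `|χ|²/p` and `-2 g Re(χ φ̄)/p` form `|χ - g φ|²/p` up to `-g²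
  -- |φ|²/p`.
  have hEd : ∀ r ∈ Ioo a b, HasDerivAt E (Complex.normSq (χ r - g r * φ r) / p r
      + (w r - g' r - g r ^ 2 / p r + q r * (U r - α) / Complex.normSq ((U r : ℂ) - c))
        * Complex.normSq (φ r)) r := by
    intro r hr
    have hp := (h.p_pos r hr).ne'
    refine ((h.hasDerivAt_energyFlux hc α hr).sub
      ((hg r hr).mul (hasDerivAt_normSq (h.hasDerivAt_φ r hr)))).congr_deriv ?_
    generalize q r * (U r - α) / Complex.normSq ((U r : ℂ) - c) = T
    simp only [Complex.normSq_apply, Complex.sub_re, Complex.sub_im, Complex.mul_re,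
      Complex.mul_im, Complex.ofReal_re, Complex.ofReal_im, Complex.div_ofReal_re,
      Complex.div_ofReal_im]
    field_simp
    ring
  have hnn : ∀ r ∈ Ioo a b, 0 ≤ Complex.normSq (χ r - g r * φ r) / p r := fun r hr =>
    div_nonneg (Complex.normSq_nonneg _) (h.p_pos r hr).le
  have hmono : MonotoneOn E (Ioo a b) := by
    refine monotoneOn_of_hasDerivWithinAt_nonneg (convex_Ioo a b)
      (fun r hr => (hEd r hr).continuousAt.continuousWithinAt)
      (fun r hr => (hEd r (interior_subset hr)).hasDerivWithinAt) (fun r hr => ?_)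
    have hr' := interior_subset hr
    exact add_nonneg (hnn r hr') (mul_nonneg (hpos r hr').le (Complex.normSq_nonneg _))
  have hE0 : ∀ r ∈ Ioo a b, E r = 0 := by
    intro r hr
    refine le_antisymm (le_of_forall_pos_lt_add fun ε hε => ?_)
      (le_of_forall_pos_lt_add fun ε hε => ?_)
    · obtain ⟨x, hx1, hx2⟩ := ((hb ε hε).and (Ioo_mem_nhdsLT hr.2)).exists
      have := hmono hr ⟨hr.1.trans hx2.1, hx2.2⟩ hx2.1.le
      change E x < ε at hx1
      linarith
    · obtain ⟨x, hx1, hx2⟩ := ((ha ε hε).and (Ioo_mem_nhdsGT hr.1)).exists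
      have := hmono ⟨hx2.1, hx2.2.trans hr.2⟩ hr hx2.2.le
      change -ε < E x at hx1
      linarith
  intro r hr
  have h1 : HasDerivAt E 0 r := (hasDerivAt_const r (0 : ℝ)).congr_of_eventuallyEq
    (by filter_upwards [Ioo_mem_nhds hr.1 hr.2] with x hx using hE0 x hx)
  have h2 := (hEd r hr).unique h1
  have h3 := hnn r hr
  have h4 := hpos r hr
  have h5 := Complex.normSq_nonneg (φ r)
  exact Complex.normSq_eq_zero.1 (by nlinarith)

/-- Comparison with a positive solution `ψ` of `(s ψ')' = -ρ ψ`, `ξ = s ψ'`, `s ≤ p`. -/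
theorem eq_zero_of_comparison (h : IsMode (Ioo a b) p w U m q c φ χ) (hc : 0 < c.im) (α : ℝ)
    {s ρ ψ ξ : ℝ → ℝ} {K : ℝ} (hs : ∀ r ∈ Ioo a b, 0 < s r) (hsp : ∀ r ∈ Ioo a b, s r ≤ p r)
    (hψ : ∀ r ∈ Ioo a b, 0 < ψ r) (hψd : ∀ r ∈ Ioo a b, HasDerivAt ψ (ξ r / s r) r)
    (hξd : ∀ r ∈ Ioo a b, HasDerivAt ξ (-ρ r * ψ r) r)
    (hpos : ∀ r ∈ Ioo a b, 0 < w r + ρ r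
      + q r * (U r - α) / Complex.normSq ((U r : ℂ) - c))
    (hφa : Tendsto φ (𝓝[>] a) (𝓝 0)) (hφb : Tendsto φ (𝓝[<] b) (𝓝 0))
    (hχa : ∀ᶠ r in 𝓝[>] a, ‖χ r‖ ≤ K) (hχb : ∀ᶠ r in 𝓝[<] b, ‖χ r‖ ≤ K)
    (hψa : φ =O[𝓝[>] a] ψ) (hψb : φ =O[𝓝[<] b] ψ)
    (hξa : ξ =O[𝓝[>] a] (fun _ => (1 : ℝ))) (hξb : ξ =O[𝓝[<] b] (fun _ => (1 : ℝ))) :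
    ∀ r ∈ Ioo a b, φ r = 0 := by
  have hlim : ∀ l : Filter ℝ, Tendsto φ l (𝓝 0) → (∀ᶠ r in l, ‖χ r‖ ≤ K) → φ =O[l] ψ →
      ξ =O[l] (fun _ => (1 : ℝ)) → Tendsto (fun r => energyFlux c α φ χ r
        - ξ r / ψ r * Complex.normSq (φ r)) l (𝓝 0) := fun l h1 h2 h3 h4 => by
    simpa using (tendsto_energyFlux h2 h1).sub (tendsto_div_mul_normSq h4 h3 h1)
  -- `g = ξ/ψ` solves `g' = -ρ - g²/s`, and `s ≤ p` makes `g²/s - g²/p` nonnegative.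
  refine h.eq_zero_of_riccati hc α (g := fun r => ξ r / ψ r)
    (g' := fun r => -ρ r - (ξ r / ψ r) ^ 2 / s r) (fun r hr => ?_) (fun r hr => ?_)
    (fun ε hε => (hlim _ hφb hχb hψb hξb).eventually (gt_mem_nhds hε))
    (fun ε hε => (hlim _ hφa hχa hψa hξa).eventually (lt_mem_nhds (neg_lt_zero.2 hε)))
  · have h1 := (hψ r hr).ne'
    have h2 := (hs r hr).ne'
    refine ((hξd r hr).div (hψd r hr) h1).congr_deriv ?_
    field_simp
  · have h1 := hpos r hr
    have h2 : (ξ r / ψ r) ^ 2 / p r ≤ (ξ r / ψ r) ^ 2 / s r := by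
      have := hs r hr
      have := hsp r hr
      gcongr
    linarith

theorem exists_norm_χ_le (h : IsMode (Ioo a b) p w U m q c φ χ) {C : ℝ}
    (hC : ∀ r ∈ Ioo a b, (w r + |q r| / ‖(U r : ℂ) - c‖) * ‖φ r‖ ≤ C) :
    ∃ K, ∀ r ∈ Ioo a b, ‖χ r‖ ≤ K := by
  refine exists_norm_le_of_hasDerivAt h.hasDerivAt_χ (C := C) fun r hr => ?_
  refine le_trans (norm_add_le _ _) (le_trans (le_of_eq ?_) (hC r hr))
  rw [norm_mul, norm_mul, norm_div, Complex.norm_real, Complex.norm_real, Real.norm_eq_abs,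
    Real.norm_eq_abs, abs_of_nonneg (h.w_nonneg r hr)]
  ring

/-- Near the axis a nonsingular `U` makes `χ` bounded. -/
theorem exists_norm_χ_le_of_nonsingular (h : IsMode (Ioo a b) p w U m q c φ χ) (hc : 0 < c.im)
    {A B C : ℝ} (hA : ∀ r ∈ Ioo a b, |U r| ≤ A) (hB : ∀ r ∈ Ioo a b, |m r| * ‖φ r‖ ≤ B)
    (hC : ∀ r ∈ Ioo a b, w r * ‖φ r‖ ≤ C) :
    ∃ K, ∀ r ∈ Ioo a b, ‖χ r‖ ≤ K := by
  -- The Wronskian has derivative `(U - c) w φ`, so no bound on `q` is needed.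
  obtain ⟨K, hK⟩ := exists_norm_le_of_hasDerivAt (C := (A + ‖c‖) * C)
    (fun r hr => h.hasDerivAt_wronskian hc hr) (fun r hr => by
      have h1 : ‖(U r : ℂ) - c‖ ≤ A + ‖c‖ := (norm_sub_le _ _).trans (by
        rw [Complex.norm_real]; exact add_le_add_left (hA r hr) _)
      have h2 : ‖(w r : ℂ) * φ r‖ ≤ C := by
        rw [norm_mul, Complex.norm_real, Real.norm_eq_abs, abs_of_nonneg (h.w_nonneg r hr)]
        exact hC r hr
      rw [norm_mul]
      have := (norm_nonneg _).trans h1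
      gcongr)
  refine ⟨(K + B) / c.im, fun r hr => ?_⟩
  rw [le_div_iff₀ hc]
  have h1 := norm_add_le (((U r : ℂ) - c) * χ r - (m r : ℂ) * φ r) ((m r : ℂ) * φ r)
  rw [sub_add_cancel, norm_mul, norm_mul (m r : ℂ), Complex.norm_real, Real.norm_eq_abs] at h1
  have h2 := mul_le_mul_of_nonneg_left (im_le_norm_sub hc (U r)) (norm_nonneg (χ r))
  have h3 := hK r hr
  have h4 := hB r hr
  linarith

end IsMode

/-! ### The Bessel functions `J₀` and `J₁` -/

/-- The exponential generating function of the sequence `a`. -/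
def egf (a : ℕ → ℝ) (t : ℝ) : ℝ := ∑' n : ℕ, a n * t ^ n / n.factorial

theorem summable_egf {a : ℕ → ℝ} (ha : ∀ n, |a n| ≤ 1) (t : ℝ) :
    Summable fun n : ℕ => a n * t ^ n / n.factorial := by
  refine Summable.of_norm_bounded (Real.summable_pow_div_factorial |t|) fun n => ?_
  rw [norm_div, norm_mul, norm_pow, Real.norm_natCast, Real.norm_eq_abs, Real.norm_eq_abs]
  gcongr
  exact mul_le_of_le_one_left (by positivity) (ha n)

/-- Termwise differentiation shifts the coefficients; the Bessel derivative formulas below are such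
shifts in the variable `x²/4`. -/
theorem hasDerivAt_egf {a : ℕ → ℝ} (ha : ∀ n, |a n| ≤ 1) (t : ℝ) :
    HasDerivAt (egf a) (egf (fun n => a (n + 1)) t) t := by
  set R : ℝ := |t| + 1
  have hR : 0 ≤ R := by positivity
  have hd : ∀ (n : ℕ) (y : ℝ), HasDerivAt (fun x => a n * x ^ n / n.factorial)
      (a n * (n * y ^ (n - 1)) / n.factorial) y := fun n y =>
    (((hasDerivAt_pow n y).const_mul (a n)).div_const _)
  have key := hasDerivAt_tsum_of_isPreconnected
    (g := fun (n : ℕ) (x : ℝ) => a n * x ^ n / n.factorial)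
    (g' := fun (n : ℕ) (y : ℝ) => a n * (n * y ^ (n - 1)) / n.factorial)
    (u := fun n : ℕ => n * R ^ (n - 1) / n.factorial) (t := Metric.ball 0 R) (y₀ := t) (y := t)
    ?_ Metric.isOpen_ball (convex_ball 0 R).isPreconnected (fun n y _ => hd n y) ?_ ?_
    (summable_egf ha t) ?_
  · refine key.congr_deriv ?_
    rw [Summable.tsum_eq_zero_add]
    · simp only [Nat.cast_zero, zero_mul, mul_zero, zero_div, zero_add, egf]
      refine tsum_congr fun n => ?_
      rw [Nat.factorial_succ]
      push_cast
      have : (n.factorial : ℝ) ≠ 0 := by positivity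
      field_simp
    · rw [← summable_nat_add_iff 1]
      refine (summable_egf (a := fun n => a (n + 1)) (fun n => ha _) t).congr fun n => ?_
      rw [Nat.factorial_succ]
      push_cast
      have : (n.factorial : ℝ) ≠ 0 := by positivity
      field_simp
  · rw [← summable_nat_add_iff 1]
    refine (Real.summable_pow_div_factorial R).congr fun n => ?_
    rw [Nat.factorial_succ]
    push_cast
    have : (n.factorial : ℝ) ≠ 0 := by positivity
    field_simp
  · intro n y hy
    have hy' : |y| ≤ R := by simpa using (Metric.mem_ball.1 hy).le
    rw [norm_div, norm_mul, norm_mul, norm_pow, Real.norm_natCast, Real.norm_natCast,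
      Real.norm_eq_abs, Real.norm_eq_abs]
    refine div_le_div_of_nonneg_right ?_ (by positivity)
    calc |a n| * (n * |y| ^ (n - 1)) ≤ 1 * (n * R ^ (n - 1)) := by
          gcongr
          exact ha n
      _ = _ := one_mul _
  · simp [R]
  · simp [R]

theorem abs_neg_one_pow_div_factorial_le (n k : ℕ) : |(-1 : ℝ) ^ n / k.factorial| ≤ 1 := by
  rw [abs_div, abs_pow, abs_neg, abs_one, one_pow, Nat.abs_cast]
  exact div_le_one_of_le₀ (by exact_mod_cast Nat.one_le_iff_ne_zero.2 k.factorial_ne_zero)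
    (by positivity)

/-- The Bessel function of the first kind of order zero. -/
def besselJ0 (x : ℝ) : ℝ := egf (fun n => (-1) ^ n / n.factorial) (x ^ 2 / 4)

theorem besselJ1_eq (x : ℝ) :
    besselJ1 x = x / 2 * egf (fun n => (-1) ^ n / (n + 1).factorial) (x ^ 2 / 4) := by
  rw [besselJ1, egf, ← tsum_mul_left]
  refine tsum_congr fun n => ?_
  have h1 : (x / 2) ^ (2 * n + 1) = x / 2 * (x ^ 2 / 4) ^ n := by
    rw [pow_succ, pow_mul]; ring
  rw [h1]
  have : (n.factorial : ℝ) ≠ 0 := by positivity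
  have : ((n + 1).factorial : ℝ) ≠ 0 := by positivity
  field_simp

theorem hasDerivAt_sq_div_four (x : ℝ) : HasDerivAt (fun x : ℝ => x ^ 2 / 4) (x / 2) x :=
  ((hasDerivAt_pow 2 x).div_const 4).congr_deriv (by norm_num; ring)

theorem egf_neg (a : ℕ → ℝ) (t : ℝ) : egf (fun n => -a n) t = -egf a t := by
  rw [egf, egf, ← tsum_neg]
  exact tsum_congr fun n => by ring

theorem hasDerivAt_besselJ0 (x : ℝ) : HasDerivAt besselJ0 (-besselJ1 x) x := by
  have h := (hasDerivAt_egf (fun n => abs_neg_one_pow_div_factorial_le n n) (x ^ 2 / 4)).comp x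
    (hasDerivAt_sq_div_four x)
  refine h.congr_deriv ?_
  have e : (fun n : ℕ => (-1 : ℝ) ^ (n + 1) / (n + 1).factorial)
      = fun n : ℕ => -((-1 : ℝ) ^ n / (n + 1).factorial) := by
    funext n; rw [pow_succ]; ring
  rw [e, egf_neg, besselJ1_eq]
  ring

theorem hasDerivAt_mul_besselJ1 (x : ℝ) :
    HasDerivAt (fun x => x * besselJ1 x) (x * besselJ0 x) x := by
  -- The `J₀` coefficients preceded by a zero: `x J₁(x) = 2 egf a (x²/4)`, and differentiating
  -- shifts back to `J₀`.
  set a : ℕ → ℝ := fun n => Nat.casesOn n 0 fun k => (-1) ^ k / k.factorial with ha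
  have ha1 : ∀ n, |a n| ≤ 1 := fun n => by
    cases n with
    | zero => simp [ha]
    | succ k => exact abs_neg_one_pow_div_factorial_le k k
  have e : (fun x => x * besselJ1 x) = fun x => 2 * egf a (x ^ 2 / 4) := by
    funext y
    have h1 : egf a (y ^ 2 / 4)
        = y ^ 2 / 4 * egf (fun n => (-1) ^ n / (n + 1).factorial) (y ^ 2 / 4) := by
      rw [egf, (summable_egf ha1 _).tsum_eq_zero_add, egf, ← tsum_mul_left]
      rw [show a 0 = 0 from rfl, zero_mul, zero_div, zero_add]
      refine tsum_congr fun n => ?_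
      rw [show a (n + 1) = (-1) ^ n / n.factorial from rfl]
      have : (n.factorial : ℝ) ≠ 0 := by positivity
      have : ((n + 1).factorial : ℝ) ≠ 0 := by positivity
      rw [pow_succ (y ^ 2 / 4)]
      field_simp
    rw [h1, besselJ1_eq]
    ring
  rw [e]
  refine (((hasDerivAt_egf ha1 (x ^ 2 / 4)).comp x
    (hasDerivAt_sq_div_four x)).const_mul 2).congr_deriv ?_
  simp only [ha, besselJ0]
  ring

theorem hasDerivAt_besselJ1 {x : ℝ} (hx : x ≠ 0) :
    HasDerivAt besselJ1 (besselJ0 x - besselJ1 x / x) x := by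
  have h := (hasDerivAt_mul_besselJ1 x).div (hasDerivAt_id x) hx
  refine (h.congr_of_eventuallyEq ?_).congr_deriv ?_
  · filter_upwards [isOpen_ne.mem_nhds hx] with y hy
    simp only [Pi.div_apply, id]
    field_simp
  · simp only [id]
    field_simp

theorem hasDerivAt_besselJ1_zero : HasDerivAt besselJ1 (1 / 2) 0 := by
  have e : besselJ1 = fun x => x / 2 * egf (fun n => (-1) ^ n / (n + 1).factorial) (x ^ 2 / 4) :=
    funext besselJ1_eq
  rw [e]
  have h1 := (hasDerivAt_egf (fun n => abs_neg_one_pow_div_factorial_le n (n + 1))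
    ((0 : ℝ) ^ 2 / 4)).comp 0 (hasDerivAt_sq_div_four 0)
  refine (((hasDerivAt_id (0 : ℝ)).div_const 2).mul h1).congr_deriv ?_
  have h2 : egf (fun n => (-1) ^ n / (n + 1).factorial) ((0 : ℝ) ^ 2 / 4) = 1 := by
    rw [egf, tsum_eq_single 0]
    · simp
    · intro n hn; simp [hn]
  simp only [Function.comp, h2, id]
  ring

theorem besselJ1_zero : besselJ1 0 = 0 := by rw [besselJ1_eq]; simp

theorem continuous_besselJ1 : Continuous besselJ1 :=
  continuous_iff_continuousAt.2 fun x => by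
    rcases eq_or_ne x 0 with rfl | hx
    · exact hasDerivAt_besselJ1_zero.continuousAt
    · exact (hasDerivAt_besselJ1 hx).continuousAt

theorem continuous_besselJ0 : Continuous besselJ0 :=
  continuous_iff_continuousAt.2 fun x => (hasDerivAt_besselJ0 x).continuousAt

theorem exists_besselJ1_pos : ∃ ε > 0, ∀ x ∈ Ioo 0 ε, 0 < besselJ1 x := by
  have h := hasDerivAt_besselJ1_zero.tendsto_slope
  have h1 : ∀ᶠ x in 𝓝[>] (0 : ℝ), 0 < slope besselJ1 0 x :=
    (h.mono_left (nhdsWithin_mono _ fun x hx => ne_of_gt hx)).eventually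
      (lt_mem_nhds (by norm_num))
  obtain ⟨ε, hε, hsub⟩ := mem_nhdsGT_iff_exists_Ioo_subset.1 h1
  refine ⟨ε, hε, fun x hx => ?_⟩
  have h2 : 0 < slope besselJ1 0 x := hsub hx
  rw [slope_def_field, besselJ1_zero, sub_zero, sub_zero] at h2
  exact (div_pos_iff_of_pos_right hx.1).1 h2

theorem besselJ1_pos_of_forall_ne {b : ℝ} (h : ∀ x ∈ Ioo 0 b, besselJ1 x ≠ 0) {x : ℝ}
    (hx : x ∈ Ioo 0 b) : 0 < besselJ1 x := by
  obtain ⟨ε, hε, hpos⟩ := exists_besselJ1_pos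
  set y := min (ε / 2) x with hy
  have hε' : 0 < ε := hε
  have hy0 : 0 < y := lt_min (by linarith) hx.1
  have hyx : y ≤ x := min_le_right _ _
  have hyp : 0 < besselJ1 y := hpos y ⟨hy0, (min_le_left _ _).trans_lt (by linarith)⟩
  by_contra! hcon
  obtain ⟨z, hz, hz0⟩ := intermediate_value_Icc' hyx continuous_besselJ1.continuousOn
    (show (0 : ℝ) ∈ Icc (besselJ1 x) (besselJ1 y) from ⟨hcon, hyp.le⟩)
  exact h z ⟨hy0.trans_le hz.1, hz.2.trans_lt hx.2⟩ hz0

/-- A positive `j ≥ j₁₁` below which `J₁` is positive, with a simple zero of `J₁` at `j`, if any. -/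
theorem exists_j11_le : ∃ j, 0 < j ∧ j11 ≤ j ∧ (∀ x ∈ Ioo 0 j, 0 < besselJ1 x) ∧
    0 ≤ besselJ1 j ∧ (besselJ1 j = 0 → besselJ0 j ≠ 0) := by
  set Z : Set ℝ := {x : ℝ | 0 < x ∧ besselJ1 x = 0} with hZ
  obtain ⟨j, hj0, hj, hne⟩ : ∃ j, 0 < j ∧ j11 ≤ j ∧ ∀ x ∈ Ioo 0 j, besselJ1 x ≠ 0 := by
    -- Were there no positive zero, `sInf ∅ = 0` would make any positive `j` admissible; the
    -- existence of a zero is thus never needed.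
    rcases Z.eq_empty_or_nonempty with h | h
    · refine ⟨1, one_pos, ?_, fun x hx h0 => ?_⟩
      · rw [j11, ← hZ, h, Real.sInf_empty]; exact zero_le_one
      · have : x ∈ Z := ⟨hx.1, h0⟩
        rw [h] at this; exact this
    · refine ⟨j11, ?_, le_rfl, fun x hx h0 => ?_⟩
      · obtain ⟨ε, hε, hpos⟩ := exists_besselJ1_pos
        have hε' : 0 < ε := hε
        refine hε'.trans_le (le_csInf h fun x hx => ?_)
        by_contra! hlt
        exact (hpos x ⟨hx.1, hlt⟩).ne' hx.2
      · exact (csInf_le ⟨0, fun y hy => hy.1.le⟩ (show x ∈ Z from ⟨hx.1, h0⟩)).not_gt hx.2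
  have hpos : ∀ x ∈ Ioo 0 j, 0 < besselJ1 x := fun x hx => besselJ1_pos_of_forall_ne hne hx
  refine ⟨j, hj0, hj, hpos, ?_, fun h1 h0 => ?_⟩
  · refine ge_of_tendsto (f := besselJ1) (x := 𝓝[<] j)
      (continuous_besselJ1.continuousAt.tendsto.mono_left nhdsWithin_le_nhds) ?_
    filter_upwards [Ioo_mem_nhdsLT hj0] with x hx using (hpos x hx).le
  -- `(x J₀)² + (x J₁)²` has derivative `2 x J₀²` and is positive at `j/2`, so `J₀` and `J₁` cannot
  -- both vanish at `j`.
  · have hd : ∀ x : ℝ, HasDerivAt (fun x => (x * besselJ0 x) ^ 2 + (x * besselJ1 x) ^ 2)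
        (2 * x * besselJ0 x ^ 2) x := fun x =>
      ((((hasDerivAt_id x).mul (hasDerivAt_besselJ0 x)).pow 2).add
        ((hasDerivAt_mul_besselJ1 x).pow 2)).congr_deriv (by simp only [id, Pi.mul_apply]; ring)
    have hmono : MonotoneOn (fun x => (x * besselJ0 x) ^ 2 + (x * besselJ1 x) ^ 2) (Icc 0 j) := by
      refine monotoneOn_of_hasDerivWithinAt_nonneg (convex_Icc 0 j)
        (fun x _ => (hd x).continuousAt.continuousWithinAt)
        (fun x _ => (hd x).hasDerivWithinAt) (fun x hx => ?_)
      have := (interior_subset hx : x ∈ Icc 0 j).1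
      positivity
    have hm : j / 2 ∈ Ioo 0 j := ⟨by linarith, by linarith⟩
    have := hmono (Ioo_subset_Icc_self hm) (right_mem_Icc.2 hj0.le) hm.2.le
    simp only [h0, h1] at this
    have := hpos _ hm
    have : 0 < (j / 2 * besselJ1 (j / 2)) ^ 2 := by positivity
    nlinarith [sq_nonneg (j / 2 * besselJ0 (j / 2))]

/-! ### Regularity of modes at the walls -/

theorem exists_Ioo_of_eventually_nhdsLT {a b : ℝ} (hab : a < b) {P : ℝ → Prop}
    (h : ∀ᶠ r in 𝓝[<] b, P r) : ∃ a' < b, Ioo a' b ⊆ Ioo a b ∧ ∀ r ∈ Ioo a' b, P r := by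
  obtain ⟨a', ha', hsub⟩ := mem_nhdsLT_iff_exists_Ioo_subset.1
    (h.and (Ioo_mem_nhdsLT hab))
  exact ⟨a', ha', fun r hr => (hsub hr).2, fun r hr => (hsub hr).1⟩

theorem exists_Ioo_of_eventually_nhdsGT {a b : ℝ} (hab : a < b) {P : ℝ → Prop}
    (h : ∀ᶠ r in 𝓝[>] a, P r) : ∃ b' > a, Ioo a b' ⊆ Ioo a b ∧ ∀ r ∈ Ioo a b', P r := by
  obtain ⟨b', hb', hsub⟩ := mem_nhdsGT_iff_exists_Ioo_subset.1
    (h.and (Ioo_mem_nhdsGT hab))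
  exact ⟨b', hb', fun r hr => (hsub hr).2, fun r hr => (hsub hr).1⟩

theorem eventually_coefficient_bounds {p w : ℝ → ℝ} {φ : ℝ → ℂ} {e : ℝ} {l : Filter ℝ}
    (hl : l ≤ 𝓝 e) (hp : ContinuousAt p e) (hpe : 0 < p e) (hw : ContinuousAt w e)
    (hφ : Tendsto φ l (𝓝 0)) :
    ∀ᶠ r in l, p e / 2 ≤ p r ∧ p r ≤ p e + 1 ∧ w r ≤ w e + 1 ∧ ‖φ r‖ ≤ 1 := by
  have h1 := hl (hp.tendsto.eventually (lt_mem_nhds (half_lt_self hpe)))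
  have h2 := hl (hp.tendsto.eventually (gt_mem_nhds (lt_add_one (p e))))
  have h3 := hl (hw.tendsto.eventually (gt_mem_nhds (lt_add_one (w e))))
  have h4 := hφ.norm.eventually (gt_mem_nhds (show ‖(0 : ℂ)‖ < 1 by simp))
  filter_upwards [h1, h2, h3, h4] with r h1 h2 h3 h4 using ⟨h1.le, h2.le, h3.le, h4.le⟩

theorem isBigO_of_hasDerivAt_ne_zero {ψ : ℝ → ℝ} {ψ' e : ℝ} {φ : ℝ → ℂ} {l : Filter ℝ}
    (hl : Tendsto id l (𝓝 e)) (hψ : HasDerivAt ψ ψ' e) (hψ' : ψ' ≠ 0) (h0 : ψ e = 0)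
    (hφ : φ =O[l] fun r => r - e) : φ =O[l] ψ := by
  refine hφ.trans ?_
  have h := (HasDerivAtFilter.isTheta_sub hψ hψ').2.comp_tendsto
    (k := fun x : ℝ => (x, e)) (hl.prodMk (tendsto_pure.2 (Eventually.of_forall fun _ => rfl)))
  simpa only [Function.comp_def, h0, sub_zero] using h

namespace IsMode

variable {p w U m q : ℝ → ℝ} {c : ℂ} {φ χ : ℝ → ℂ} {a b : ℝ}

theorem eventually_energyFlux_lt_of_continuousAt (h : IsMode (Ioo a b) p w U m q c φ χ)
    (hab : a < b) (hc : 0 < c.im) {α : ℝ} (hp : ContinuousAt p b) (hpb : 0 < p b)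
    (hw : ContinuousAt w b) (hq : ∀ r ∈ Ioo a b, 0 ≤ q r * (U r - α))
    (hφ : Tendsto φ (𝓝[<] b) (𝓝 0)) {ε : ℝ} (hε : 0 < ε) :
    ∀ᶠ r in 𝓝[<] b, energyFlux c α φ χ r < ε := by
  obtain ⟨a', ha', hsub, hP⟩ := exists_Ioo_of_eventually_nhdsLT hab
    (eventually_coefficient_bounds nhdsWithin_le_nhds hp hpb hw hφ)
  exact (h.mono hsub).eventually_energyFlux_lt ha' hc (half_pos hpb) (fun r hr => (hP r hr).1)
    (fun r hr => (hP r hr).2.1) (fun r hr => (hP r hr).2.2.1) (fun r hr => (hP r hr).2.2.2)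
    (fun r hr => hq r (hsub hr)) hφ hε

theorem eventually_lt_energyFlux_of_continuousAt (h : IsMode (Ioo a b) p w U m q c φ χ)
    (hab : a < b) (hc : 0 < c.im) {α : ℝ} (hp : ContinuousAt p a) (hpa : 0 < p a)
    (hw : ContinuousAt w a) (hq : ∀ r ∈ Ioo a b, 0 ≤ q r * (U r - α))
    (hφ : Tendsto φ (𝓝[>] a) (𝓝 0)) {ε : ℝ} (hε : 0 < ε) :
    ∀ᶠ r in 𝓝[>] a, -ε < energyFlux c α φ χ r := by
  obtain ⟨b', hb', hsub, hP⟩ := exists_Ioo_of_eventually_nhdsGT hab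
    (eventually_coefficient_bounds nhdsWithin_le_nhds hp hpa hw hφ)
  exact (h.mono hsub).eventually_lt_energyFlux hb' hc (half_pos hpa) (fun r hr => (hP r hr).1)
    (fun r hr => (hP r hr).2.1) (fun r hr => (hP r hr).2.2.1) (fun r hr => (hP r hr).2.2.2)
    (fun r hr => hq r (hsub hr)) hφ hε

/-- With bounded coefficients the mode is regular at the ends of the interval. -/
theorem exists_norm_χ_le_and_isBigO (h : IsMode (Ioo a b) p w U m q c φ χ) {p₀ w₁ C e : ℝ}
    {l : Filter ℝ} [l.NeBot] (hl : l ≤ 𝓝 e) (hmem : Ioo a b ∈ l) (hp₀ : 0 < p₀)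
    (hp : ∀ r ∈ Ioo a b, p₀ ≤ p r) (hw : ∀ r ∈ Ioo a b, w r ≤ w₁)
    (hq : ∀ r ∈ Ioo a b, |q r| / ‖(U r : ℂ) - c‖ ≤ C) (hφ1 : ∀ r ∈ Ioo a b, ‖φ r‖ ≤ 1)
    (hφ : Tendsto φ l (𝓝 0)) :
    ∃ K, (∀ᶠ r in l, ‖χ r‖ ≤ K) ∧ φ =O[l] fun r => r - e := by
  obtain ⟨K, hK⟩ := h.exists_norm_χ_le (C := w₁ + C) fun r hr => by
    have h1 := h.w_nonneg r hr
    have h2 := hw r hr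
    have h3 := hq r hr
    have h4 : 0 ≤ |q r| / ‖(U r : ℂ) - c‖ := by positivity
    calc _ ≤ (w r + |q r| / ‖(U r : ℂ) - c‖) * 1 := by
          have := hφ1 r hr
          gcongr
      _ ≤ _ := by linarith
  refine ⟨K, Filter.mem_of_superset hmem hK, Asymptotics.IsBigO.of_bound (K / p₀) ?_⟩
  filter_upwards [hmem] with r hr
  rw [Real.norm_eq_abs]
  refine norm_le_mul_abs_sub_of_tendsto (convex_Ioo a b) hl hmem h.hasDerivAt_φ
    (fun x hx => ?_) hφ hr
  rw [norm_div, Complex.norm_real, Real.norm_eq_abs, abs_of_pos (h.p_pos x hx)]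
  have h1 := hK x hx
  have h2 := hp x hx
  have h3 := (norm_nonneg _).trans h1
  gcongr

theorem regular_right (h : IsMode (Ioo a b) p w U m q c φ χ) (hab : a < b) {C : ℝ}
    (hp : ContinuousAt p b) (hpb : 0 < p b) (hw : ContinuousAt w b)
    (hq : ∀ᶠ r in 𝓝[<] b, |q r| / ‖(U r : ℂ) - c‖ ≤ C) (hφ : Tendsto φ (𝓝[<] b) (𝓝 0)) :
    ∃ K, (∀ᶠ r in 𝓝[<] b, ‖χ r‖ ≤ K) ∧ φ =O[𝓝[<] b] fun r => r - b := by
  obtain ⟨a', ha', hsub, hP⟩ := exists_Ioo_of_eventually_nhdsLT hab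
    ((eventually_coefficient_bounds nhdsWithin_le_nhds hp hpb hw hφ).and hq)
  exact (h.mono hsub).exists_norm_χ_le_and_isBigO nhdsWithin_le_nhds (Ioo_mem_nhdsLT ha')
    (half_pos hpb) (fun r hr => (hP r hr).1.1) (fun r hr => (hP r hr).1.2.2.1)
    (fun r hr => (hP r hr).2) (fun r hr => (hP r hr).1.2.2.2) hφ

theorem regular_left (h : IsMode (Ioo a b) p w U m q c φ χ) (hab : a < b) {C : ℝ}
    (hp : ContinuousAt p a) (hpa : 0 < p a) (hw : ContinuousAt w a)
    (hq : ∀ᶠ r in 𝓝[>] a, |q r| / ‖(U r : ℂ) - c‖ ≤ C) (hφ : Tendsto φ (𝓝[>] a) (𝓝 0)) :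
    ∃ K, (∀ᶠ r in 𝓝[>] a, ‖χ r‖ ≤ K) ∧ φ =O[𝓝[>] a] fun r => r - a := by
  obtain ⟨b', hb', hsub, hP⟩ := exists_Ioo_of_eventually_nhdsGT hab
    ((eventually_coefficient_bounds nhdsWithin_le_nhds hp hpa hw hφ).and hq)
  exact (h.mono hsub).exists_norm_χ_le_and_isBigO nhdsWithin_le_nhds (Ioo_mem_nhdsGT hb')
    (half_pos hpa) (fun r hr => (hP r hr).1.1) (fun r hr => (hP r hr).1.2.2.1)
    (fun r hr => (hP r hr).2) (fun r hr => (hP r hr).1.2.2.2) hφ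

end IsMode

/-! ### From the conditions on `W` to bounds on the coefficients -/

theorem abs_div_norm_sub_le {c : ℂ} (hc : 0 < c.im) {r q u β H θ : ℝ} (hr : 0 < r)
    (hθ : θ ∈ Icc 0 H) (hq : r * q = -θ * (u - β)) :
    |q| / ‖(u : ℂ) - c‖ ≤ H / r * (1 + ‖c - β‖ / c.im) := by
  have hD : 0 < ‖(u : ℂ) - c‖ := hc.trans_le (im_le_norm_sub hc _)
  have h1 : |q| = θ / r * |u - β| := by
    have : q = -(θ / r * (u - β)) := by field_simp; linarith
    rw [this, abs_neg, abs_mul, abs_of_nonneg (div_nonneg hθ.1 hr.le)]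
  rw [div_le_iff₀ hD, h1, mul_assoc]
  have h2 := abs_sub_le_mul_norm_sub hc u β
  have h3 := hθ.2
  have h4 := hθ.1.trans hθ.2
  gcongr

/-- With `α = 2 Re c - β`, `(u - β)(u - α) = (u - Re c)² - (Re c - β)²`, which is less than `|u -
c|²`. Strictness comes from `Im c > 0` and `H' > 0`, while `H` itself may vanish. -/
theorem neg_div_lt_of_mem_Icc {c : ℂ} (hc : 0 < c.im) {r q u β H H' θ : ℝ} (hr : 0 < r)
    (hθ : θ ∈ Icc 0 H) (hq : r * q = -θ * (u - β)) (hH : H ≤ H') (hH' : 0 < H') :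
    -(H' / r) < q * (u - (2 * c.re - β)) / Complex.normSq ((u : ℂ) - c) := by
  have hN : Complex.normSq ((u : ℂ) - c) = (u - c.re) ^ 2 + c.im ^ 2 := by
    simp [Complex.normSq_apply]; ring
  have hN0 : 0 < (u - c.re) ^ 2 + c.im ^ 2 := by positivity
  rw [hN, ← neg_div, div_lt_div_iff₀ hr hN0]
  have e : q * (u - (2 * c.re - β)) * r = -(θ * ((u - c.re) ^ 2 - (c.re - β) ^ 2)) := by
    linear_combination (u - (2 * c.re - β)) * hq
  rw [e]
  have h1 : θ * (u - c.re) ^ 2 ≤ H' * (u - c.re) ^ 2 := by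
    have := hθ.2
    gcongr
    linarith
  have h2 : 0 ≤ θ * (c.re - β) ^ 2 := mul_nonneg hθ.1 (sq_nonneg _)
  have h3 : 0 < H' * c.im ^ 2 := by positivity
  nlinarith

theorem IsSolution.isMode {Ω : Set ℝ} {U : ℝ → ℝ} {N k : ℝ} {c : ℂ} {G : ℝ → ℂ}
    (h : IsSolution Ω U N k c G) (hΩ : IsOpen Ω) (hpos : ∀ r ∈ Ω, 0 < r)
    (hU : DifferentiableOn ℝ U Ω) (hU' : DifferentiableOn ℝ (deriv U) Ω) :
    IsMode Ω (fun r => r / (N ^ 2 + r ^ 2)) (fun r => k ^ 2 / r) U (fun r => -Q U N r)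
      (fun r => -deriv (Q U N) r) c (fun r => r * G r) (flux N G) where
  p_pos r hr := by have := hpos r hr; positivity
  w_nonneg r hr := by have := hpos r hr; positivity
  hasDerivAt_U r hr := by
    have h0 := hpos r hr
    refine ((hU r hr).differentiableAt (hΩ.mem_nhds hr)).hasDerivAt.congr_deriv ?_
    simp only [Q]
    field_simp
  hasDerivAt_m r hr := by
    have h0 := hpos r hr
    have h1 := (hU' r hr).differentiableAt (hΩ.mem_nhds hr)
    have h2 : DifferentiableAt ℝ (Q U N) r := by
      unfold Q
      exact ((differentiableAt_id.mul h1).neg).div (by fun_prop) (by positivity)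
    exact h2.hasDerivAt.neg
  hasDerivAt_φ r hr := by
    have h0 := hpos r hr
    have h1 := (h.differentiable r hr).differentiableAt (hΩ.mem_nhds hr)
    have h2 : DifferentiableAt ℝ (fun s : ℝ => (s : ℂ) * G s) r :=
      (Complex.ofRealCLM.differentiableAt).mul h1
    refine h2.hasDerivAt.congr_deriv ?_
    have h3 : ((r / (N ^ 2 + r ^ 2) : ℝ) : ℂ) ≠ 0 := by
      have : r / (N ^ 2 + r ^ 2) ≠ 0 := by positivity
      exact_mod_cast this
    rw [flux, mul_div_cancel_left₀ _ h3]
  hasDerivAt_χ r hr := by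
    have h0 : (r : ℂ) ≠ 0 := by exact_mod_cast (hpos r hr).ne'
    refine ((h.flux_differentiable r hr).differentiableAt
      (hΩ.mem_nhds hr)).hasDerivAt.congr_deriv ?_
    have h1 := h.equation r hr
    push_cast
    have h2 : (k : ℂ) ^ 2 / r * (r * G r) = (k : ℂ) ^ 2 * G r := by field_simp
    rw [h2]
    linear_combination h1

theorem IsSolution.false_of_forall_eq_zero {Ω : Set ℝ} {U : ℝ → ℝ} {N k : ℝ} {c : ℂ}
    {G : ℝ → ℂ} (h : IsSolution Ω U N k c G) (hpos : ∀ r ∈ Ω, 0 < r)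
    (h0 : ∀ r ∈ Ω, (r : ℂ) * G r = 0) : False := by
  obtain ⟨r, hr, hne⟩ := h.nontrivial
  refine mul_ne_zero ?_ hne (h0 r hr)
  exact_mod_cast (hpos r hr).ne'

theorem mul_sub_nonneg_of_W_nonpos {U : ℝ → ℝ} {α N r : ℝ} (hr : 0 < r)
    (h : U r ≠ α → W U α N r ≤ 0) : 0 ≤ -deriv (Q U N) r * (U r - α) := by
  rcases eq_or_ne (U r) α with h0 | h0
  · simp [h0]
  · have h1 := h h0
    have h2 : U r - α ≠ 0 := sub_ne_zero.2 h0
    have h3 : deriv (Q U N) r * (U r - α) = W U α N r * ((U r - α) ^ 2 / r) := by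
      unfold W; field_simp
    have h4 : 0 ≤ (U r - α) ^ 2 / r := by positivity
    nlinarith

/-- The bounds on `W` in the form `r Q' = θ (U - β)` with `θ ∈ [0, H]`, valid also where
`U = β`. -/
theorem exists_mem_Icc_of_W_mem {Ω : Set ℝ} (hΩ : IsOpen Ω) {p w U : ℝ → ℝ} {N β M : ℝ} {c : ℂ}
    {φ χ : ℝ → ℂ} {H : ℝ → ℝ} (hpos : ∀ r ∈ Ω, 0 < r)
    (h : IsMode Ω p w U (fun r => -Q U N r) (fun r => -deriv (Q U N) r) c φ χ)
    (hW : ∀ r ∈ Ω, U r ≠ β → W U β N r ∈ Icc 0 (H r)) (hH0 : ∀ r ∈ Ω, 0 ≤ H r)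
    (hHM : ∀ r ∈ Ω, H r ≤ M) {r : ℝ} (hr : r ∈ Ω) :
    ∃ θ ∈ Icc 0 (H r), r * -deriv (Q U N) r = -θ * (U r - β) := by
  rcases eq_or_ne (U r) β with h0 | h0
  · refine ⟨0, left_mem_Icc.2 (hH0 r hr), ?_⟩
    have hr0 := hpos r hr
    -- The condition on `W` is silent where `U = β`, so `Q' = 0` is recovered from nearby points;
    -- staying above `r/2` bounds `1/x`.
    have := eq_zero_of_abs_le_mul_abs (V := fun x => U x - β) (M := M / (r / 2))
      (S := Ω ∩ Ioi (r / 2)) (hΩ.inter isOpen_Ioi) ⟨hr, show r / 2 < r by linarith⟩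
      (fun x hx => h.p_pos x hx.1) (fun x hx => (h.hasDerivAt_U x hx.1).sub_const β)
      (fun x hx => h.hasDerivAt_m x hx.1) (by simp [h0]) (fun x hx hne => by
        have hx0 := hpos x hx.1
        have hWx := hW x hx.1 (sub_ne_zero.1 hne)
        have e : -deriv (Q U N) x = -(W U β N x / x * (U x - β)) := by
          unfold W; field_simp
        rw [e, abs_neg, abs_mul, abs_of_nonneg (div_nonneg hWx.1 hx0.le)]
        have h1 := hWx.2.trans (hHM x hx.1)
        have h2 : r / 2 ≤ x := (show r / 2 < x from hx.2).le
        have h3 := hWx.1.trans h1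
        gcongr)
    rw [this]; simp
  · refine ⟨W U β N r, hW r hr h0, ?_⟩
    have : U r - β ≠ 0 := sub_ne_zero.2 h0
    unfold W; field_simp

theorem isBigO_one_of_continuousAt {ξ : ℝ → ℝ} {e : ℝ} {l : Filter ℝ} (hl : l ≤ 𝓝 e)
    (h : ContinuousAt ξ e) : ξ =O[l] (fun _ => (1 : ℝ)) :=
  (h.tendsto.mono_left hl).isBigO_one ℝ

/-- The integrality of the azimuthal wavenumber enters here: `n ≠ 0` forces `n ≥ 1`. -/
theorem one_div_sq_le {k : ℝ} {n : ℕ} (hn : (n : ℝ) / k ≠ 0) :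
    1 / ((n : ℝ) / k) ^ 2 ≤ k ^ 2 := by
  have h1 : n ≠ 0 := by rintro rfl; simp at hn
  have h2 : (1 : ℝ) ≤ n := by exact_mod_cast Nat.one_le_iff_ne_zero.2 h1
  rw [div_pow, one_div_div, div_le_iff₀ (by positivity)]
  nlinarith [sq_nonneg k, mul_nonneg (sq_nonneg k) (show (0 : ℝ) ≤ n ^ 2 - 1 by nlinarith)]

theorem continuousAt_p {N e : ℝ} (he : 0 < e) :
    ContinuousAt (fun r : ℝ => r / (N ^ 2 + r ^ 2)) e :=
  continuousAt_id.div (by fun_prop) (by positivity)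

theorem continuousAt_w {k e : ℝ} (he : 0 < e) : ContinuousAt (fun r : ℝ => k ^ 2 / r) e :=
  continuousAt_const.div continuousAt_id he.ne'

/-! ### The annulus -/

theorem annulusStable_of_KAI_or_KAII {ri ro : ℝ} {U : ℝ → ℝ} (hri : 0 < ri) (hro : ri < ro)
    (hU : DifferentiableOn ℝ U (Ioo ri ro)) (hU' : DifferentiableOn ℝ (deriv U) (Ioo ri ro))
    (hKA : ∀ N : ℝ, 0 ≤ N → KAI (Ioo ri ro) U N ∨ KAII (Ioo ri ro) U N (annulusH ri ro N)) :
    AnnulusStable ri ro U := by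
  rintro k n c hk ⟨G, hG, hGi, hGo⟩ hc
  have hro0 : 0 < ro := hri.trans hro
  have hpos : ∀ r ∈ Ioo ri ro, 0 < r := fun r hr => hri.trans hr.1
  have hmode := hG.isMode isOpen_Ioo hpos hU hU'
  set N : ℝ := n / k with hN
  have hlim : ∀ (e : ℝ) (l : Filter ℝ), l ≤ 𝓝 e → Tendsto G l (𝓝 0) →
      Tendsto (fun r : ℝ => (r : ℂ) * G r) l (𝓝 0) := fun e l hl h => by
    have h1 : Tendsto (fun r : ℝ => (r : ℂ)) l (𝓝 (e : ℂ)) :=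
      (Complex.continuous_ofReal.tendsto e).mono_left hl
    simpa using h1.mul h
  have hφi := hlim ri _ nhdsWithin_le_nhds hGi
  have hφo := hlim ro _ nhdsWithin_le_nhds hGo
  have hpp : ∀ e : ℝ, 0 < e → 0 < e / (N ^ 2 + e ^ 2) := fun e he => by positivity
  refine hG.false_of_forall_eq_zero hpos ?_
  rcases hKA N (by positivity) with ⟨α, hα⟩ | ⟨β, hβ⟩
  · have hq : ∀ r ∈ Ioo ri ro, 0 ≤ -deriv (Q U N) r * (U r - α) := fun r hr =>
      mul_sub_nonneg_of_W_nonpos (hpos r hr) (hα r hr)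
    -- With `g = 0` Picone's identity is the plain energy identity.
    refine hmode.eq_zero_of_riccati hc α (g := fun _ => 0) (g' := fun _ => 0)
      (fun r _ => hasDerivAt_const r 0) (fun r hr => ?_) (fun ε hε => ?_) (fun ε hε => ?_)
    · have h1 := div_nonneg (hq r hr) (Complex.normSq_nonneg ((U r : ℂ) - c))
      have h2 : 0 < k ^ 2 / r := div_pos (by positivity) (hpos r hr)
      simpa using add_pos_of_pos_of_nonneg h2 h1
    · simpa using hmode.eventually_energyFlux_lt_of_continuousAt hro hc (continuousAt_p hro0)
        (hpp ro hro0) (continuousAt_w hro0) hq hφo hε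
    · simpa using hmode.eventually_lt_energyFlux_of_continuousAt hro hc (continuousAt_p hri)
        (hpp ri hri) (continuousAt_w hri) hq hφi hε
  -- `S` bounds `N² + r²` from above. Replacing `p` by `r/S` gives an Euler equation, solved by
  -- `sin(ω log(r/ri))`; this `ω` places its first two zeros at the walls.
  · set ω : ℝ := Real.pi / Real.log (ro / ri) with hω
    set S : ℝ := N ^ 2 + ro ^ 2 with hS
    have hlog : 0 < Real.log (ro / ri) := Real.log_pos ((one_lt_div hri).2 hro)
    have hω0 : 0 < ω := div_pos Real.pi_pos hlog
    have hS0 : 0 < S := by positivity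
    have hω2 : (Real.pi / Real.log (ri / ro)) ^ 2 = ω ^ 2 := by
      rw [hω, ← inv_div ro ri, Real.log_inv, div_neg, neg_sq]
    obtain ⟨H, hH0, hHk, hHeq⟩ : ∃ H, 0 < H ∧ H ≤ k ^ 2 + ω ^ 2 / S ∧
        ∀ r, annulusH ri ro N r = H := by
      by_cases h0 : N = 0
      · refine ⟨ω ^ 2 / S, by positivity, by linarith [sq_nonneg k], fun r => ?_⟩
        rw [annulusH, if_pos h0, hω2, hS, h0]; ring
      · refine ⟨ω ^ 2 / S + 1 / N ^ 2, by positivity, ?_, fun r => ?_⟩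
        · have := one_div_sq_le h0
          rw [← hN] at this
          linarith
        · rw [annulusH, if_neg h0, hω2, hS]; ring
    have hθ : ∀ r ∈ Ioo ri ro, ∃ θ ∈ Icc 0 H, r * -deriv (Q U N) r = -θ * (U r - β) :=
      fun r hr => by
        have := exists_mem_Icc_of_W_mem isOpen_Ioo hpos hmode hβ (M := H)
          (fun x _ => by rw [hHeq]; exact hH0.le) (fun x _ => (hHeq x).le) hr
        rwa [hHeq] at this
    have hqC : ∀ r ∈ Ioo ri ro, |-deriv (Q U N) r| / ‖(U r : ℂ) - c‖ ≤
        H / ri * (1 + ‖c - β‖ / c.im) := fun r hr => by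
      obtain ⟨θ, hθ1, hθ2⟩ := hθ r hr
      refine (abs_div_norm_sub_le hc (hpos r hr) hθ1 hθ2).trans ?_
      have := hr.1.le
      gcongr
    obtain ⟨K₁, hχi, hOi⟩ := hmode.regular_left hro (continuousAt_p hri) (hpp ri hri)
      (continuousAt_w hri) (by filter_upwards [Ioo_mem_nhdsGT hro] with r hr using hqC r hr) hφi
    obtain ⟨K₂, hχo, hOo⟩ := hmode.regular_right hro (continuousAt_p hro0) (hpp ro hro0)
      (continuousAt_w hro0) (by filter_upwards [Ioo_mem_nhdsLT hro] with r hr using hqC r hr) hφo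
    have hθd : ∀ r : ℝ, 0 < r → HasDerivAt (fun r => ω * Real.log (r / ri)) (ω / r) r :=
      fun r hr => by
        refine ((((hasDerivAt_id r).div_const ri).log
          (div_pos hr hri).ne').const_mul ω).congr_deriv ?_
        simp only [id]
        field_simp
    have hψd : ∀ r : ℝ, 0 < r → HasDerivAt (fun r => Real.sin (ω * Real.log (r / ri)))
        (Real.cos (ω * Real.log (r / ri)) * (ω / r)) r := fun r hr => (hθd r hr).sin
    have hξd : ∀ r : ℝ, 0 < r → HasDerivAt (fun r => ω / S * Real.cos (ω * Real.log (r / ri)))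
        (ω / S * (-Real.sin (ω * Real.log (r / ri)) * (ω / r))) r :=
      fun r hr => (hθd r hr).cos.const_mul _
    have hωlog : ω * Real.log (ro / ri) = Real.pi := by
      rw [hω, div_mul_cancel₀ _ hlog.ne']
    refine hmode.eq_zero_of_comparison hc (2 * c.re - β) (K := max K₁ K₂)
      (s := fun r => r / S) (ρ := fun r => ω ^ 2 / S / r)
      (ψ := fun r => Real.sin (ω * Real.log (r / ri)))
      (ξ := fun r => ω / S * Real.cos (ω * Real.log (r / ri)))
      (fun r hr => div_pos (hpos r hr) hS0) (fun r hr => ?_) (fun r hr => ?_) (fun r hr => ?_)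
      (fun r hr => ?_) (fun r hr => ?_) hφi hφo (hχi.mono fun r hr => hr.trans (le_max_left _ _))
      (hχo.mono fun r hr => hr.trans (le_max_right _ _)) ?_ ?_
      (isBigO_one_of_continuousAt nhdsWithin_le_nhds (hξd ri hri).continuousAt)
      (isBigO_one_of_continuousAt nhdsWithin_le_nhds (hξd ro hro0).continuousAt)
    · have h1 := hpos r hr
      have h2 := hr.2.le
      rw [hS]
      gcongr
    · have h1 : 0 < Real.log (r / ri) := Real.log_pos ((one_lt_div hri).2 hr.1)
      have h2 : Real.log (r / ri) < Real.log (ro / ri) :=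
        Real.log_lt_log (div_pos (hpos r hr) hri) (by have := hr.2; gcongr)
      refine Real.sin_pos_of_pos_of_lt_pi (by positivity) ?_
      rw [← hωlog]
      gcongr
    · refine (hψd r (hpos r hr)).congr_deriv ?_
      have := (hpos r hr).ne'
      field_simp
    · refine (hξd r (hpos r hr)).congr_deriv ?_
      have := (hpos r hr).ne'
      field_simp
    · obtain ⟨θ, hθ1, hθ2⟩ := hθ r hr
      have h1 := neg_div_lt_of_mem_Icc hc (hpos r hr) hθ1 hθ2 le_rfl hH0
      have h2 : H / r ≤ k ^ 2 / r + ω ^ 2 / S / r := by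
        rw [← add_div]
        have := hpos r hr
        gcongr
      linarith
    · refine isBigO_of_hasDerivAt_ne_zero nhdsWithin_le_nhds (hψd ri hri) ?_ ?_ hOi
      · simp [hri.ne', hω0.ne']
      · simp [hri.ne']
    · refine isBigO_of_hasDerivAt_ne_zero nhdsWithin_le_nhds (hψd ro hro0) ?_ ?_ hOo
      · rw [hωlog, Real.cos_pi]
        simp [hro0.ne', hω0.ne']
      · rw [hωlog, Real.sin_pi]

/-! ### The pipe -/

theorem differentiableOn_of_even_extension {U : ℝ → ℝ}
    (hU : ContDiffOn ℝ 1 (fun r : ℝ => U |r|) (Ioo (-1) 1)) :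
    DifferentiableOn ℝ U (Ioo 0 1) := fun r hr => by
  have h1 : DifferentiableAt ℝ (fun r : ℝ => U |r|) r :=
    (hU.differentiableOn one_ne_zero r ⟨by linarith [hr.1], hr.2⟩).differentiableAt
      (Ioo_mem_nhds (by linarith [hr.1]) hr.2)
  refine (h1.congr_of_eventuallyEq ?_).differentiableWithinAt
  filter_upwards [Ioi_mem_nhds hr.1] with x hx
  rw [abs_of_pos hx]

theorem exists_eventually_abs_le_of_even_extension {U : ℝ → ℝ}
    (hU : ContDiffOn ℝ 1 (fun r : ℝ => U |r|) (Ioo (-1) 1)) :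
    ∃ A, ∀ᶠ r in 𝓝[>] 0, |U r| ≤ A ∧ |deriv U r| ≤ A := by
  have hmem : Ioo (-1 : ℝ) 1 ∈ 𝓝 0 := Ioo_mem_nhds (by norm_num) (by norm_num)
  have h1 : ContinuousAt (fun r : ℝ => U |r|) 0 := hU.continuousOn.continuousAt hmem
  have h2 : ContinuousAt (deriv fun r : ℝ => U |r|) 0 :=
    (hU.continuousOn_deriv_of_isOpen isOpen_Ioo le_rfl).continuousAt hmem
  set A := max (|U (|0|)|) (|deriv (fun r : ℝ => U |r|) 0|) + 1
  have e1 := h1.abs.tendsto.eventually (gt_mem_nhds (show |U (|0|)| < A from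
    lt_add_of_le_of_pos (le_max_left _ _) one_pos))
  have e2 := h2.abs.tendsto.eventually (gt_mem_nhds
    (show |deriv (fun r : ℝ => U |r|) 0| < A from
      lt_add_of_le_of_pos (le_max_right _ _) one_pos))
  refine ⟨A, ?_⟩
  filter_upwards [nhdsWithin_le_nhds e1, nhdsWithin_le_nhds e2, self_mem_nhdsWithin]
    with r h1 h2 hr
  have hr' : 0 < r := hr
  have h3 : deriv (fun r : ℝ => U |r|) r = deriv U r := by
    refine Filter.EventuallyEq.deriv_eq ?_
    filter_upwards [Ioi_mem_nhds hr'] with x hx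
    rw [abs_of_pos hx]
  rw [h3] at h2
  rw [abs_of_pos hr'] at h1
  exact ⟨h1.le, h2.le⟩

/-- Regularity of the modes at the axis of the pipe. -/
theorem exists_norm_flux_le_of_even_extension {U : ℝ → ℝ} {N k M : ℝ} {c : ℂ} {G : ℝ → ℂ}
    (hU : ContDiffOn ℝ 1 (fun r : ℝ => U |r|) (Ioo (-1) 1)) (hc : 0 < c.im)
    (h : IsMode (Ioo 0 1) (fun r => r / (N ^ 2 + r ^ 2)) (fun r => k ^ 2 / r) U
      (fun r => -Q U N r) (fun r => -deriv (Q U N) r) c (fun r => r * G r) (flux N G))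
    (hM : ∀ᶠ r in 𝓝[>] 0, ‖G r‖ ≤ M) :
    ∃ K, ∃ δ > 0, ∀ r ∈ Ioo 0 δ, r ∈ Ioo (0 : ℝ) 1 ∧ ‖flux N G r‖ ≤ K := by
  obtain ⟨A, hA⟩ := exists_eventually_abs_le_of_even_extension hU
  obtain ⟨δ, hδ, hsub, hP⟩ := exists_Ioo_of_eventually_nhdsGT one_pos (hM.and hA)
  obtain ⟨K, hK⟩ := (h.mono hsub).exists_norm_χ_le_of_nonsingular hc (A := A) (B := A * M)
    (C := k ^ 2 * M) (fun r hr => (hP r hr).2.1) (fun r hr => by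
      have hr0 : 0 < r := hr.1
      have h1 := (hP r hr).2.2
      have h2 := (hP r hr).1
      have h3 : r ^ 2 / (N ^ 2 + r ^ 2) ≤ 1 :=
        div_le_one_of_le₀ (by nlinarith [sq_nonneg N]) (by positivity)
      have e : |-Q U N r| * ‖(r : ℂ) * G r‖ = r ^ 2 / (N ^ 2 + r ^ 2) * (|deriv U r| * ‖G r‖) := by
        have h4 : 0 < N ^ 2 + r ^ 2 := by positivity
        rw [Q, abs_neg, abs_div, abs_neg, abs_mul, abs_of_pos hr0, abs_of_pos h4, norm_mul,
          Complex.norm_real, Real.norm_eq_abs, abs_of_pos hr0]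
        ring
      rw [e]
      have h5 := (abs_nonneg _).trans h1
      calc _ ≤ 1 * (A * M) := by gcongr
        _ = _ := one_mul _) (fun r hr => by
      have hr0 : 0 < r := hr.1
      have h2 := (hP r hr).1
      -- The factor `r` in `φ = r G` cancels the pole of `w` on the axis.
      have e : k ^ 2 / r * ‖(r : ℂ) * G r‖ = k ^ 2 * ‖G r‖ := by
        rw [norm_mul, Complex.norm_real, Real.norm_eq_abs, abs_of_pos hr0]
        field_simp
      rw [e]
      gcongr)
  exact ⟨K, δ, hδ, fun r hr => ⟨hsub hr, hK r hr⟩⟩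

theorem j11_nonneg : 0 ≤ j11 := Real.sInf_nonneg fun _ hx => hx.1.le

theorem hasDerivAt_comp_mul_left {f : ℝ → ℝ} {f' j r : ℝ} (h : HasDerivAt f f' (j * r)) :
    HasDerivAt (fun r => f (j * r)) (j * f') r := by
  have h1 : HasDerivAt (fun r : ℝ => j * r) j r := by
    simpa using (hasDerivAt_id r).const_mul j
  exact (h.comp r h1).congr_deriv (by ring)

theorem isBigO_comp_besselJ1_zero {j : ℝ} (hj : 0 < j) {φ : ℝ → ℂ}
    (hφ : φ =O[𝓝[>] 0] fun r => r) : φ =O[𝓝[>] 0] fun r => besselJ1 (j * r) := by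
  refine isBigO_of_hasDerivAt_ne_zero (e := 0) nhdsWithin_le_nhds
    (hasDerivAt_comp_mul_left (by rw [mul_zero]; exact hasDerivAt_besselJ1_zero))
    (by positivity) (by simp [besselJ1_zero]) (by simpa using hφ)

/-- A mode that decays linearly at the wall is dominated by a comparison function with at most a
simple zero there. -/
theorem isBigO_of_ne_zero_or {ψ : ℝ → ℝ} {ψ' e : ℝ} {φ : ℝ → ℂ} {l : Filter ℝ}
    (hl : l ≤ 𝓝 e) (hψ : HasDerivAt ψ ψ' e) (hψ' : ψ e = 0 → ψ' ≠ 0)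
    (hφ : φ =O[l] fun r => r - e) : φ =O[l] ψ := by
  by_cases h0 : ψ e = 0
  · exact isBigO_of_hasDerivAt_ne_zero hl hψ (hψ' h0) h0 hφ
  · refine (hφ.trans (isBigO_one_of_continuousAt hl (by fun_prop))).trans ?_
    have h1 : ∀ᶠ r in l, |ψ e| / 2 < |ψ r| :=
      hl (hψ.continuousAt.abs.tendsto.eventually (lt_mem_nhds (half_lt_self (abs_pos.2 h0))))
    refine Asymptotics.IsBigO.of_bound (2 / |ψ e|) ?_
    filter_upwards [h1] with r hr
    have h2 := abs_pos.2 h0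
    rw [norm_one, Real.norm_eq_abs, div_mul_eq_mul_div, le_div_iff₀ h2]
    linarith

theorem pipeStable_of_KAI_or_KAII {U : ℝ → ℝ}
    (hU : ContDiffOn ℝ 1 (fun r : ℝ => U |r|) (Ioo (-1) 1))
    (hU' : DifferentiableOn ℝ (deriv U) (Ioo 0 1))
    (hKA : ∀ N : ℝ, 0 ≤ N → KAI (Ioo 0 1) U N ∨ KAII (Ioo 0 1) U N (pipeH N)) :
    PipeStable U := by
  rintro k n c hk ⟨G, hG, ⟨M, hM⟩, hG1⟩ hc
  have hpos : ∀ r ∈ Ioo (0 : ℝ) 1, 0 < r := fun r hr => hr.1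
  have hmode := hG.isMode isOpen_Ioo hpos (differentiableOn_of_even_extension hU) hU'
  set N : ℝ := n / k with hN
  obtain ⟨K₁, δ, hδ, hK₁⟩ := exists_norm_flux_le_of_even_extension hU hc hmode hM
  have hχ0 : ∀ᶠ r in 𝓝[>] 0, ‖flux N G r‖ ≤ K₁ := by
    filter_upwards [Ioo_mem_nhdsGT hδ] with r hr using (hK₁ r hr).2
  have hO0 : (fun r : ℝ => (r : ℂ) * G r) =O[𝓝[>] 0] fun r => r := by
    refine Asymptotics.IsBigO.of_bound M ?_
    filter_upwards [hM] with r hr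
    rw [norm_mul, Complex.norm_real, mul_comm]
    gcongr
  have hφ0 : Tendsto (fun r : ℝ => (r : ℂ) * G r) (𝓝[>] 0) (𝓝 0) :=
    hO0.trans_tendsto (tendsto_id.mono_left nhdsWithin_le_nhds)
  have hφ1 : Tendsto (fun r : ℝ => (r : ℂ) * G r) (𝓝[<] 1) (𝓝 0) := by
    have h1 : Tendsto (fun r : ℝ => (r : ℂ)) (𝓝[<] 1) (𝓝 ((1 : ℝ) : ℂ)) :=
      (Complex.continuous_ofReal.tendsto 1).mono_left nhdsWithin_le_nhds
    simpa using h1.mul hG1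
  have hp1 : 0 < (1 : ℝ) / (N ^ 2 + 1 ^ 2) := by positivity
  refine hG.false_of_forall_eq_zero hpos ?_
  rcases hKA N (by positivity) with ⟨α, hα⟩ | ⟨β, hβ⟩
  · have hq : ∀ r ∈ Ioo (0 : ℝ) 1, 0 ≤ -deriv (Q U N) r * (U r - α) := fun r hr =>
      mul_sub_nonneg_of_W_nonpos (hpos r hr) (hα r hr)
    refine hmode.eq_zero_of_riccati hc α (g := fun _ => 0) (g' := fun _ => 0)
      (fun r _ => hasDerivAt_const r 0) (fun r hr => ?_) (fun ε hε => ?_) (fun ε hε => ?_)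
    · have h1 := div_nonneg (hq r hr) (Complex.normSq_nonneg ((U r : ℂ) - c))
      have h2 : 0 < k ^ 2 / r := div_pos (by positivity) (hpos r hr)
      simpa using add_pos_of_pos_of_nonneg h2 h1
    · simpa using hmode.eventually_energyFlux_lt_of_continuousAt one_pos hc
        (continuousAt_p one_pos) hp1 (continuousAt_w one_pos) hq hφ1 hε
    -- On the axis `χ` is bounded, so the flux simply tends to zero.
    · simpa using (tendsto_energyFlux (α := α) (c := c) hχ0 hφ0).eventually
        (lt_mem_nhds (neg_lt_zero.2 hε))
  · obtain ⟨j, hj0, hj11, hJ, hj1, hj2⟩ := exists_j11_le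
    have hjr : ∀ r ∈ Ioo (0 : ℝ) 1, 0 < besselJ1 (j * r) := fun r hr =>
      hJ _ ⟨mul_pos hj0 hr.1, by nlinarith [hr.2]⟩
    have hj11sq : j11 ^ 2 ≤ j ^ 2 := pow_le_pow_left₀ j11_nonneg hj11 2
    -- The threshold with `j` in place of `j11`: at least as large, and visibly positive.
    set H' : ℝ → ℝ := fun r => if N = 0 then j ^ 2 else (j ^ 2 * r ^ 2 + 1 / N ^ 2) / (N ^ 2 + 1)
      with hH'
    have hHH' : ∀ r, pipeH N r ≤ H' r := fun r => by
      simp only [pipeH, hH']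
      split_ifs with h0
      · exact hj11sq
      · gcongr
    have hH0 : ∀ r, 0 ≤ pipeH N r := fun r => by
      simp only [pipeH]
      split_ifs with h0 <;> positivity
    have hH'0 : ∀ r, 0 < H' r := fun r => by
      simp only [hH']
      split_ifs with h0 <;> positivity
    have hH'1 : ∀ r ∈ Ioo (0 : ℝ) 1, H' r ≤ H' 1 := fun r hr => by
      simp only [hH']
      split_ifs with h0
      · exact le_rfl
      · have h1 := hr.1.le
        have h2 := hr.2.le
        gcongr
    have hθ : ∀ r ∈ Ioo (0 : ℝ) 1, ∃ θ ∈ Icc 0 (pipeH N r),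
        r * -deriv (Q U N) r = -θ * (U r - β) := fun r hr =>
      exists_mem_Icc_of_W_mem isOpen_Ioo hpos hmode hβ (M := H' 1) (fun x _ => hH0 x)
        (fun x hx => (hHH' x).trans (hH'1 x hx)) hr
    have hqC : ∀ᶠ r in 𝓝[<] 1, |-deriv (Q U N) r| / ‖(U r : ℂ) - c‖ ≤
        H' 1 / (1 / 2) * (1 + ‖c - β‖ / c.im) := by
      filter_upwards [Ioo_mem_nhdsLT (show (1 / 2 : ℝ) < 1 by norm_num)] with r hr
      have hr' : r ∈ Ioo (0 : ℝ) 1 := ⟨by linarith [hr.1], hr.2⟩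
      obtain ⟨θ, hθ1, hθ2⟩ := hθ r hr'
      refine (abs_div_norm_sub_le hc hr'.1 hθ1 hθ2).trans ?_
      have h1 := hr.1.le
      have h2 := (hHH' r).trans (hH'1 r hr')
      have h3 := (hH'0 1).le
      gcongr
    obtain ⟨K₂, hχ1, hO1⟩ := hmode.regular_right one_pos (continuousAt_p one_pos) hp1
      (continuousAt_w one_pos) hqC hφ1
    have hT : ∀ r ∈ Ioo (0 : ℝ) 1, -(H' r / r) < -deriv (Q U N) r * (U r - (2 * c.re - β))
        / Complex.normSq ((U r : ℂ) - c) := fun r hr => by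
      obtain ⟨θ, hθ1, hθ2⟩ := hθ r hr
      exact neg_div_lt_of_mem_Icc hc hr.1 hθ1 hθ2 (hHH' r) (hH'0 r)
    have hχ0' : ∀ᶠ r in 𝓝[>] 0, ‖flux N G r‖ ≤ max K₁ K₂ :=
      hχ0.mono fun r hr => hr.trans (le_max_left _ _)
    have hχ1' : ∀ᶠ r in 𝓝[<] 1, ‖flux N G r‖ ≤ max K₁ K₂ :=
      hχ1.mono fun r hr => hr.trans (le_max_right _ _)
    by_cases h0 : N = 0
    -- For `N = 0`, `p = 1/r` exactly, so `s = p`, and `ψ = r J₁(j r)` solves `(ψ'/r)' = -(j²/r) ψ`.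
    · have hψd : ∀ r : ℝ, HasDerivAt (fun r => r * besselJ1 (j * r))
          (r * (j * besselJ0 (j * r))) r := fun r => by
        have h1 := (hasDerivAt_comp_mul_left (hasDerivAt_mul_besselJ1 (j * r))).const_mul j⁻¹
        refine (h1.congr_of_eventuallyEq (Eventually.of_forall fun x => ?_)).congr_deriv ?_
        · field_simp
        · field_simp
      have hξd : ∀ r : ℝ, HasDerivAt (fun r => j * besselJ0 (j * r))
          (j * (j * -besselJ1 (j * r))) r := fun r =>
        (hasDerivAt_comp_mul_left (hasDerivAt_besselJ0 (j * r))).const_mul j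
      refine hmode.eq_zero_of_comparison hc (2 * c.re - β) (K := max K₁ K₂)
        (s := fun r => 1 / r) (ρ := fun r => j ^ 2 / r)
        (ψ := fun r => r * besselJ1 (j * r)) (ξ := fun r => j * besselJ0 (j * r))
        (fun r hr => one_div_pos.2 hr.1) (fun r hr => ?_) (fun r hr => mul_pos hr.1 (hjr r hr))
        (fun r hr => ?_) (fun r hr => ?_) (fun r hr => ?_) hφ0 hφ1 hχ0' hχ1' ?_ ?_
        (isBigO_one_of_continuousAt nhdsWithin_le_nhds (hξd 0).continuousAt)
        (isBigO_one_of_continuousAt nhdsWithin_le_nhds (hξd 1).continuousAt)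
      · have := hr.1.ne'
        rw [h0]
        apply le_of_eq
        field_simp
        ring
      · refine (hψd r).congr_deriv ?_
        have := hr.1.ne'
        field_simp
      · refine (hξd r).congr_deriv ?_
        have := hr.1.ne'
        field_simp
      · have h1 := hT r hr
        simp only [hH', if_pos h0] at h1
        have h2 : 0 ≤ k ^ 2 / r := div_nonneg (sq_nonneg k) hr.1.le
        linarith
      -- This `ψ` vanishes to second order on the axis, so `φ = O(r)` is not enough; `φ' = r χ` with
      -- `χ` bounded gives `O(r²)`.
      · have hO2 : (fun r : ℝ => (r : ℂ) * G r) =O[𝓝[>] 0] fun r => r * r := by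
          refine Asymptotics.IsBigO.of_bound K₁ ?_
          filter_upwards [Ioo_mem_nhdsGT hδ] with r hr
          have hsub : Ioc 0 r ⊆ Ioo 0 δ := fun x hx => ⟨hx.1, hx.2.trans_lt hr.2⟩
          have h1 := norm_le_mul_abs_sub_of_tendsto (C := K₁ * r) (convex_Ioc 0 r)
            (l := 𝓝[>] 0) nhdsWithin_le_nhds (Ioc_mem_nhdsGT hr.1)
            (fun x hx => hmode.hasDerivAt_φ x (hK₁ x (hsub hx)).1) (fun x hx => by
              have h2 := (hK₁ x (hsub hx)).2
              have hx0 := hx.1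
              have hx1 := hx.2
              have e : x / (N ^ 2 + x ^ 2) = x⁻¹ := by
                rw [h0]; field_simp; ring
              rw [e, norm_div, Complex.norm_real, norm_inv, div_inv_eq_mul, Real.norm_eq_abs,
                abs_of_pos hx0]
              have h3 := (norm_nonneg _).trans h2
              gcongr) hφ0 (right_mem_Ioc.2 hr.1)
          rw [sub_zero, abs_of_pos hr.1] at h1
          rw [Real.norm_eq_abs, abs_of_pos (mul_pos hr.1 hr.1), ← mul_assoc]
          exact h1
        refine hO2.trans ((Asymptotics.isBigO_refl _ _).mul ?_)
        have h1 : (fun r : ℝ => (r : ℂ)) =O[𝓝[>] 0] fun r => r :=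
          Asymptotics.IsBigO.of_bound 1 (Eventually.of_forall fun r => by simp)
        refine Asymptotics.IsBigO.trans (Asymptotics.IsBigO.of_bound 1
          (Eventually.of_forall fun r => by simp)) (isBigO_comp_besselJ1_zero hj0 h1)
      · refine isBigO_of_ne_zero_or nhdsWithin_le_nhds (hψd 1) (fun h1 => ?_) hO1
        rw [mul_one, one_mul] at h1
        rw [mul_one, one_mul]
        exact mul_ne_zero hj0.ne' (hj2 h1)
    -- For `N > 0`, `p ≥ r/(N² + 1)`, and Bessel's equation `(r ψ')' = (1/r - j² r) ψ` for `ψ = J₁(j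
    -- r)` dictates `ρ`.
    · have hψd : ∀ r : ℝ, 0 < r → HasDerivAt (fun r => besselJ1 (j * r))
          (j * (besselJ0 (j * r) - besselJ1 (j * r) / (j * r))) r := fun r hr =>
        hasDerivAt_comp_mul_left (hasDerivAt_besselJ1 (by positivity))
      have hξd : ∀ r : ℝ, 0 < r → HasDerivAt
          (fun r => (j * r * besselJ0 (j * r) - besselJ1 (j * r)) / (N ^ 2 + 1))
          ((j * (besselJ1 (j * r) / (j * r) - j * r * besselJ1 (j * r))) / (N ^ 2 + 1)) r :=
        fun r hr => by
          have hx : j * r ≠ 0 := by positivity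
          have h1 : HasDerivAt (fun x => x * besselJ0 x - besselJ1 x)
              (besselJ1 (j * r) / (j * r) - j * r * besselJ1 (j * r)) (j * r) :=
            (((hasDerivAt_id _).mul (hasDerivAt_besselJ0 _)).sub
              (hasDerivAt_besselJ1 hx)).congr_deriv (by ring)
          exact (hasDerivAt_comp_mul_left h1).div_const _
      have hξc : Continuous
          (fun r => (j * r * besselJ0 (j * r) - besselJ1 (j * r)) / (N ^ 2 + 1)) := by
        have h1 := continuous_besselJ0
        have h2 := continuous_besselJ1
        fun_prop
      refine hmode.eq_zero_of_comparison hc (2 * c.re - β) (K := max K₁ K₂)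
        (s := fun r => r / (N ^ 2 + 1)) (ρ := fun r => (j ^ 2 * r - 1 / r) / (N ^ 2 + 1))
        (ψ := fun r => besselJ1 (j * r))
        (ξ := fun r => (j * r * besselJ0 (j * r) - besselJ1 (j * r)) / (N ^ 2 + 1))
        (fun r hr => div_pos hr.1 (by positivity)) (fun r hr => ?_) hjr
        (fun r hr => ?_) (fun r hr => ?_) (fun r hr => ?_) hφ0 hφ1 hχ0' hχ1'
        (isBigO_comp_besselJ1_zero hj0 hO0) ?_
        (isBigO_one_of_continuousAt nhdsWithin_le_nhds hξc.continuousAt)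
        (isBigO_one_of_continuousAt nhdsWithin_le_nhds hξc.continuousAt)
      · have h1 := hr.1
        have h2 : r ^ 2 ≤ 1 := pow_le_one₀ hr.1.le hr.2.le
        gcongr
      · refine (hψd r hr.1).congr_deriv ?_
        have := hr.1.ne'
        field_simp
      · refine (hξd r hr.1).congr_deriv ?_
        have := hr.1.ne'
        field_simp
        ring
      · have h1 := hT r hr
        simp only [hH', if_neg h0] at h1
        have h2 := one_div_sq_le h0
        rw [← hN] at h2
        have h3 : 1 / N ^ 2 / r ≤ k ^ 2 / r := by
          have := hr.1
          gcongr
        -- The form of the threshold comes from `1/N² - 1/(N² + 1) = 1/(N² (N² + 1))`.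
        have h4 : (j ^ 2 * r ^ 2 + 1 / N ^ 2) / (N ^ 2 + 1) / r =
            1 / N ^ 2 / r + (j ^ 2 * r - 1 / r) / (N ^ 2 + 1) := by
          have := hr.1.ne'
          field_simp
          ring
        linarith
      · refine isBigO_of_ne_zero_or nhdsWithin_le_nhds (hψd 1 one_pos) (fun h1 => ?_) hO1
        rw [mul_one] at h1
        rw [mul_one, h1, zero_div, sub_zero]
        exact mul_ne_zero hj0.ne' (hj2 h1)

end AxisymmetricFlow

end

theorem theorem1 :
    (∀ (ri ro : ℝ) (U : ℝ → ℝ), 0 < ri → ri < ro →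
      ContDiffOn ℝ 1 U (Set.Ioo ri ro) →
      DifferentiableOn ℝ (deriv U) (Set.Ioo ri ro) →
      (∀ N : ℝ, 0 ≤ N →
        AxisymmetricFlow.KAI (Set.Ioo ri ro) U N ∨
        AxisymmetricFlow.KAII (Set.Ioo ri ro) U N (AxisymmetricFlow.annulusH ri ro N)) →
      AxisymmetricFlow.AnnulusStable ri ro U) ∧
    (∀ U : ℝ → ℝ,
      ContDiffOn ℝ 1 (fun r : ℝ => U |r|) (Set.Ioo (-1) 1) →
      DifferentiableOn ℝ (deriv U) (Set.Ioo 0 1) →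
      (∀ N : ℝ, 0 ≤ N →
        AxisymmetricFlow.KAI (Set.Ioo 0 1) U N ∨
        AxisymmetricFlow.KAII (Set.Ioo 0 1) U N (AxisymmetricFlow.pipeH N)) →
      AxisymmetricFlow.PipeStable U) := by
  exact ⟨fun ri ro U hri hro hU hU' hKA =>
      AxisymmetricFlow.annulusStable_of_KAI_or_KAII hri hro
        (hU.differentiableOn one_ne_zero) hU' hKA,
    fun U hU hU' hKA => AxisymmetricFlow.pipeStable_of_KAI_or_KAII hU hU' hKA⟩
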